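/- A Boolean constraint language $\Gamma$ is a set of relations $R\subseteq\{0,1\}^{r}$ of finite arities. A formula over $\Gamma$ is a finite conjunction (with repetitions) of constraints $R(x_1,\dots,x_r)$ with $R\in\Gamma$; the cost of an assignment is the number of constraints that it violates. In Weighted Min SAT$(\Gamma)$ the input is a formula $\mathcal F$ over $\Gamma$, a weight function $\omega:\mathcal F\to\mathbb Z_{>0}$ and integers $k,W\ge 0$; the question is whether there is a set $Z\subseteq\mathcal F$ with $|Z|\le k$ and $\omega(Z)\le W$ such that $\mathcal F-Z$ is satisfiable; the parameter is $k$ (weights and bounds are written in binary, relations as truth tables). The problem is called trivial if every non-empty $R\in\Gamma$ contains the all-0 tuple, or every non-empty $R\in\Gamma$ contains the all-1 tuple. The Gaifman graph $G_R$ of an $r$-ary relation $R$ has vertex set $\{1,\dots,r\}$, and distinct $i,j$ are adjacent iff there are $a,b\in\{0,1\}$ such that no $t\in R$ has $t_i=a$ and $t_j=b$. It contains a $2K_2$ if it has an induced subgraph isomorphic to the disjoint union of two edges. $\Gamma$ supports crisp $R(X)$ if for every $k\in\mathbb N$ there is a formula over $\Gamma$ on $X$ and auxiliary variables $Y$ such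 that every assignment of $X$ in $R$ extends to an assignment of cost $0$, while every extension of any other assignment of $X$ has cost greater than $k$. $\Gamma$ proportionally implements $R(X)$ if there are a formula $\mathcal F$ over $\Gamma$ on $X$ and auxiliary variables $Y$ and an integer $c>0$ such that for every assignment of $X$ the minimum, over the assignments of $Y$, of the cost of $\mathcal F$ is $0$ if $X\in R$ and $c$ if $X\notin R$. W[1] is the class of parameterized problems that have an FPT-reduction, for some $d\ge1$, to the problem of deciding whether a given $d$-CNF formula has a satisfying assignment setting exactly $k$ of its variables to true (parameter $k$). An FPT-reduction is a map that preserves the answer, is computable in time $f(k)\,n^{O(1)}$ on inputs of size $n$ with parameter $k$, and produces instances with parameter at most $g(k)$, for computable $f,g$. A problem is W[1]-hard if every problem in W[1] has an FPT-reduction to it. Lemma. Let $\Gamma$ be a Boolean constraint language that contains a relation $R$ whose Gaifman graph $G_R$ contains a $2K_2$, that supports crisp $(\neg x\vee\neg y)$, and that proportionally implements $(x=y)$ or $(x\to y)$. Then Weighted Min SAT$(\Gamma)$ is trivial or W[1]-hard. -/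

import Mathlib

/-! ## A programming language with a running time

Data are binary trees whose leaves are natural numbers.  Numbers count with their length in
binary, and every elementary instruction is charged the size of its input and of its output,
so that running times agree with those of Turing machines up to a polynomial. -/

/-- Data: natural numbers, and ordered pairs of data. -/
inductive Data where
  | num (n : ℕ)
  | pair (a b : Data)
  deriving DecidableEq

namespace Data

/-- The size of a piece of data; a number has its binary length as size (plus one). -/
def size : Data → ℕ
  | num n => Nat.size n + 1
  | pair a b => size a + size b + 1

end Data

/-- Elementary instructions. -/
inductive Instr where
  | id
  | const (v : Data)
  | fst
  | snd
  | add
  | sub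
  | mul
  | le
  | eq

namespace Instr

/-- The effect of an elementary instruction.  The arithmetical ones expect a pair of numbers;
on data of the wrong shape an instruction returns `0`. -/
def apply : Instr → Data → Data
  | id, x => x
  | const v, _ => v
  | fst, .pair a _ => a
  | snd, .pair _ b => b
  | add, .pair (.num m) (.num n) => .num (m + n)
  | sub, .pair (.num m) (.num n) => .num (m - n)
  | mul, .pair (.num m) (.num n) => .num (m * n)
  | le, .pair (.num m) (.num n) => .num (if m ≤ n then 1 else 0)
  | eq, .pair a b => .num (if a = b then 1 else 0)
  | _, _ => .num 0

end Instr

/-- Programs.  `loop c p` is the loop "while `c` is true of the current value, apply `p`". -/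
inductive Prog where
  | instr (i : Instr)
  | seq (p q : Prog)
  | pair (p q : Prog)
  | ite (c p q : Prog)
  | loop (c p : Prog)

/-- `Runs p x y t`: on input `x` the program `p` halts with output `y` after time `t`.
The result `0` of a test means "false", every other result means "true". -/
inductive Runs : Prog → Data → Data → ℕ → Prop where
  | instr (i : Instr) (x : Data) :
      Runs (.instr i) x (i.apply x) (x.size + (i.apply x).size)
  | seq {p q : Prog} {x y z : Data} {s t : ℕ} :
      Runs p x y s → Runs q y z t → Runs (.seq p q) x z (s + t + 1)
  | pair {p q : Prog} {x y z : Data} {s t : ℕ} :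
      Runs p x y s → Runs q x z t → Runs (.pair p q) x (.pair y z) (s + t + 1)
  | ite_true {c p q : Prog} {x b y : Data} {s t : ℕ} :
      Runs c x b s → b ≠ .num 0 → Runs p x y t → Runs (.ite c p q) x y (s + t + 1)
  | ite_false {c p q : Prog} {x y : Data} {s t : ℕ} :
      Runs c x (.num 0) s → Runs q x y t → Runs (.ite c p q) x y (s + t + 1)
  | loop_stop {c p : Prog} {x : Data} {s : ℕ} :
      Runs c x (.num 0) s → Runs (.loop c p) x x (s + 1)
  | loop_step {c p : Prog} {x b y z : Data} {s t u : ℕ} :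
      Runs c x b s → b ≠ .num 0 → Runs p x y t → Runs (.loop c p) y z u →
      Runs (.loop c p) x z (s + t + u + 1)

/-! ## Encodings -/

/-- A type whose elements are written down as data. -/
class DataEnc (α : Type) where
  enc : α → Data
  enc_injective : Function.Injective enc

namespace DataEnc

instance : DataEnc ℕ where
  enc := Data.num
  enc_injective := fun _ _ h => Data.num.inj h

instance : DataEnc Bool where
  enc b := Data.num b.toNat
  enc_injective := by
    intro a b h
    cases a <;> cases b <;> simp_all

instance {α β : Type} [DataEnc α] [DataEnc β] : DataEnc (α × β) where
  enc x := Data.pair (enc x.1) (enc x.2)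
  enc_injective := by
    rintro ⟨a, b⟩ ⟨c, d⟩ h
    obtain ⟨h₁, h₂⟩ := Data.pair.inj h
    exact Prod.ext (enc_injective h₁) (enc_injective h₂)

instance {α : Type} [DataEnc α] (p : α → Prop) : DataEnc {a : α // p a} where
  enc x := enc x.1
  enc_injective := fun _ _ h => Subtype.ext (enc_injective h)

/-- Lists are nested pairs, ending in `0`. -/
def encList {α : Type} [DataEnc α] : List α → Data
  | [] => Data.num 0
  | a :: l => Data.pair (enc a) (encList l)

theorem encList_injective {α : Type} [DataEnc α] :
    Function.Injective (encList : List α → Data) := by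
  intro l
  induction l with
  | nil => intro m h; cases m <;> simp_all [encList]
  | cons a l ih =>
    intro m h
    cases m with
    | nil => simp [encList] at h
    | cons b m =>
      obtain ⟨h₁, h₂⟩ := Data.pair.inj h
      rw [enc_injective h₁, ih h₂]

instance {α : Type} [DataEnc α] : DataEnc (List α) where
  enc := encList
  enc_injective := encList_injective

end DataEnc

/-! ## Parameterized problems and the class W[1] -/

/-- A parameterized decision problem: instances (written down as data), a parameter for every
instance, and the set of yes-instances. -/
structure ParamProblem where
  Inst : Type
  dataEnc : DataEnc Inst
  param : Inst → ℕ
  Yes : Inst → Prop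

namespace ParamProblem

/-- The data that represent an instance. -/
def encode (P : ParamProblem) (x : P.Inst) : Data := P.dataEnc.enc x

/-- `P` has an FPT-reduction to `Q`: a map `r` of instances that preserves the answer,
is computed in time `f(k) · n ^ c` on instances of size `n` and parameter `k`, and produces
instances of parameter at most `g(k)`, where `f` and `g` are computable. -/
def FPTReducible (P Q : ParamProblem) : Prop :=
  ∃ (r : P.Inst → Q.Inst) (p : Prog) (f g : ℕ → ℕ) (c : ℕ),
    Computable f ∧ Computable g ∧
    ∀ x : P.Inst,
      (P.Yes x ↔ Q.Yes (r x)) ∧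
      Q.param (r x) ≤ g (P.param x) ∧
      ∃ t : ℕ, Runs p (P.encode x) (Q.encode (r x)) t ∧
        t ≤ f (P.param x) * (P.encode x).size ^ c

end ParamProblem

/-- A literal: `(v, true)` is the variable `v`, and `(v, false)` is its negation. -/
abbrev Literal : Type := ℕ × Bool

/-- A formula in conjunctive normal form, as a list of clauses. -/
abbrev CNF : Type := List (List Literal)

/-- The set of variables that occur in a formula. -/
def CNF.vars (φ : CNF) : Finset ℕ := (φ.flatten.map Prod.fst).toFinset

/-- The assignment with exactly the variables in `S` true satisfies `φ`. -/
def CNF.SatisfiedBy (φ : CNF) (S : Finset ℕ) : Prop :=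
  ∀ C ∈ φ, ∃ l ∈ C, (l.1 ∈ S ↔ l.2 = true)

/-- Weighted satisfiability of `d`-CNF formulas: given a conjunction `φ` of clauses with at most
`d` literals each, and `k`, is there a satisfying assignment that sets exactly `k` of the
variables of `φ` to true?  The parameter is `k`. -/
def weightedSat (d : ℕ) : ParamProblem where
  Inst := {φ : CNF // ∀ C ∈ φ, C.length ≤ d} × ℕ
  dataEnc := inferInstance
  param x := x.2
  Yes x := ∃ S : Finset ℕ, S ⊆ CNF.vars x.1.1 ∧ S.card = x.2 ∧ CNF.SatisfiedBy x.1.1 S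

/-- The class W[1]: the closure under FPT-reductions of the weighted satisfiability problems
of `d`-CNF formulas, `d ≥ 1`. -/
def InW1 (P : ParamProblem) : Prop :=
  ∃ d : ℕ, 1 ≤ d ∧ P.FPTReducible (weightedSat d)

/-- `Q` is W[1]-hard: every problem in W[1] has an FPT-reduction to `Q`. -/
def W1Hard (Q : ParamProblem) : Prop :=
  ∀ P : ParamProblem, InW1 P → P.FPTReducible Q

/-! ## Boolean constraint languages -/

/-- A Boolean relation of finite arity. -/
structure BoolRel where
  arity : ℕ
  tuples : Finset (Fin arity → Bool)

/-- A Boolean constraint language: a set of Boolean relations (finite or not). -/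
abbrev ConstraintLang : Type := Set BoolRel

namespace BoolRel

/-- The truth table of a relation: entry `j` tells whether the tuple of the binary digits of `j`
is in the relation. -/
def truthTable (R : BoolRel) : List Bool :=
  List.ofFn fun j : Fin (2 ^ R.arity) =>
    decide ((fun i : Fin R.arity => (j : ℕ).testBit i) ∈ R.tuples)

/-- The Gaifman graph: `i` and `j` are adjacent if the projection of `R` onto the arguments
`i` and `j` is not all of `{0,1}²`. -/
def gaifman (R : BoolRel) : SimpleGraph (Fin R.arity) where
  Adj i j := i ≠ j ∧ ∃ a b : Bool, ∀ t ∈ R.tuples, ¬ (t i = a ∧ t j = b)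
  symm := ⟨by
    rintro i j ⟨hij, a, b, h⟩
    exact ⟨hij.symm, b, a, fun t ht hh => h t ht ⟨hh.2, hh.1⟩⟩⟩
  loopless := ⟨fun i h => h.1 rfl⟩

/-- The relation contains the constant tuple `(b, …, b)`. -/
def Valid (R : BoolRel) (b : Bool) : Prop := (fun _ => b) ∈ R.tuples

/-- The relation `x = y`. -/
def equality : BoolRel := ⟨2, Finset.univ.filter fun t => t 0 = t 1⟩

/-- The relation `x → y`. -/
def implication : BoolRel := ⟨2, Finset.univ.filter fun t => t 0 = true → t 1 = true⟩

/-- The relation `¬ x ∨ ¬ y`. -/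
def negClause₂ : BoolRel := ⟨2, Finset.univ.filter fun t => t 0 = false ∨ t 1 = false⟩

/-- The cost function of a relation: `0` on its tuples, `1` elsewhere. -/
def costFn (R : BoolRel) (x : Fin R.arity → Bool) : ℕ := if x ∈ R.tuples then 0 else 1

end BoolRel

/-- The graph `2K₂`: two vertex-disjoint edges, with no further edge. -/
def twoK₂ : SimpleGraph (Fin 2 ⊕ Fin 2) :=
  SimpleGraph.sum (⊤ : SimpleGraph (Fin 2)) (⊤ : SimpleGraph (Fin 2))

/-- A constraint over `Γ` with variables from `V`: a relation of `Γ` and a scope. -/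
structure Constraint (Γ : ConstraintLang) (V : Type) where
  rel : BoolRel
  mem : rel ∈ Γ
  scope : Fin rel.arity → V

/-- The assignment `α` satisfies the constraint. -/
def Constraint.Sat {Γ : ConstraintLang} {V : Type} (C : Constraint Γ V) (α : V → Bool) : Prop :=
  (fun i => α (C.scope i)) ∈ C.rel.tuples

instance {Γ : ConstraintLang} {V : Type} (C : Constraint Γ V) (α : V → Bool) :
    Decidable (C.Sat α) := by
  unfold Constraint.Sat; infer_instance

/-- A formula over `Γ`: a list of constraints (repetitions count). -/
abbrev Formula (Γ : ConstraintLang) (V : Type) : Type := List (Constraint Γ V)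

/-- The cost of an assignment: the number of violated constraints. -/
def Formula.cost {Γ : ConstraintLang} {V : Type} (F : Formula Γ V) (α : V → Bool) : ℕ :=
  F.countP fun C => decide (¬ C.Sat α)

/-- `Γ` supports crisp constraints `R(X)`: for every `k` there is a formula over `Γ`, on the
variables `X` and auxiliary variables `Y`, such that assignments of `X` in `R` extend to an
assignment of cost `0`, while all extensions of the other assignments cost more than `k`. -/
def SupportsCrisp (Γ : ConstraintLang) (R : BoolRel) : Prop :=
  ∀ k : ℕ, ∃ (m : ℕ) (F : Formula Γ (Fin R.arity ⊕ Fin m)),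
    ∀ x : Fin R.arity → Bool,
      (x ∈ R.tuples → ∃ y : Fin m → Bool, F.cost (Sum.elim x y) = 0) ∧
      (x ∉ R.tuples → ∀ y : Fin m → Bool, k < F.cost (Sum.elim x y))

/-- `Γ` proportionally implements the cost function `f`: there are a formula `F` over `Γ`, on the
variables `X` and auxiliary variables `Y`, and a constant `c > 0` with
`c * f X = min_Y (cost of F on (X, Y))` for all `X`. -/
def PropImplements (Γ : ConstraintLang) {r : ℕ} (f : (Fin r → Bool) → ℕ) : Prop :=
  ∃ (m : ℕ) (F : Formula Γ (Fin r ⊕ Fin m)) (c : ℕ), 0 < c ∧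
    ∀ x : Fin r → Bool,
      IsLeast (Set.range fun y : Fin m → Bool => F.cost (Sum.elim x y)) (c * f x)

/-! ## Weighted Min SAT -/

/-- A constraint with variables from `ℕ`, together with a positive integer weight. -/
structure WConstraint (Γ : ConstraintLang) extends Constraint Γ ℕ where
  weight : ℕ+

/-- An instance of Weighted Min SAT(Γ): a formula with positive weights on its constraints, and
the bounds `k` and `W`. -/
structure WMinSATInst (Γ : ConstraintLang) where
  formula : List (WConstraint Γ)
  k : ℕ
  W : ℕ

/-- A constraint is written down as its truth table, its scope, and its weight in binary. -/
instance (Γ : ConstraintLang) : DataEnc (WConstraint Γ) where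
  enc C := DataEnc.enc (C.rel.truthTable, List.ofFn C.scope, (C.weight : ℕ))
  enc_injective := by
    rintro ⟨⟨⟨r, T⟩, hR, s⟩, w⟩ ⟨⟨⟨r', T'⟩, hR', s'⟩, w'⟩ h
    have h := DataEnc.enc_injective h
    simp only [Prod.mk.injEq] at h
    obtain ⟨hT, hs, hw⟩ := h
    have hr : r = r' := by simpa using congrArg List.length hs
    subst hr
    obtain rfl : s = s' := List.ofFn_injective hs
    obtain rfl : w = w' := PNat.coe_injective hw
    have hT := List.ofFn_injective hT
    obtain rfl : T = T' := by
      ext t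
      have := congrFun hT ⟨Nat.ofBits t, Nat.ofBits_lt_two_pow t⟩
      simpa using this
    rfl

instance (Γ : ConstraintLang) : DataEnc (WMinSATInst Γ) where
  enc I := DataEnc.enc (I.formula, I.k, I.W)
  enc_injective := by
    rintro ⟨F, k, W⟩ ⟨F', k', W'⟩ h
    have h := DataEnc.enc_injective h
    simp only [Prod.mk.injEq] at h
    obtain ⟨rfl, rfl, rfl⟩ := h
    rfl

/-- `Z` is a deletion set: some assignment satisfies all constraints outside of `Z`. -/
def IsDeletionSet {Γ : ConstraintLang} (F : List (WConstraint Γ)) (Z : Finset (Fin F.length)) : Prop :=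
  ∃ α : ℕ → Bool, ∀ i : Fin F.length, i ∉ Z → (F.get i).toConstraint.Sat α

/-- Weighted Min SAT(Γ): is there a deletion set of at most `k` constraints and of total weight
at most `W`?  The parameter is `k`. -/
def weightedMinSAT (Γ : ConstraintLang) : ParamProblem where
  Inst := WMinSATInst Γ
  dataEnc := inferInstance
  param I := I.k
  Yes I := ∃ Z : Finset (Fin I.formula.length), IsDeletionSet I.formula Z ∧
    Z.card ≤ I.k ∧ ∑ i ∈ Z, ((I.formula.get i).weight : ℕ) ≤ I.W

/-- (Weighted) Min SAT(Γ) is trivial: every non-empty relation of `Γ` contains the all-0 tuple,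
or every non-empty relation of `Γ` contains the all-1 tuple. -/
def TrivialMinSAT (Γ : ConstraintLang) : Prop :=
  ∃ b : Bool, ∀ R ∈ Γ, R.tuples.Nonempty → R.Valid b

/-! If `Γ` is not trivial, it has a non-empty relation without the all-0 tuple; with the crisp
clause `¬x ∨ ¬y` it provides both constants. It remains to reduce `weightedSat d` to Weighted Min
SAT(Γ) for every `d`. The reduction goes through a binary constraint satisfaction problem with `K`
variables and `N` values, where `K` is bounded in terms of the parameter and `d`.

The two edges of a `2K₂` exclude one pattern each, while the projection onto one end of each edge is
full. With suitable polarities, a single constraint is then violated if `x₀ > x₁` or `x₂ > x₃`, and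
satisfiable if `x₀ = x₁` and `x₂ = x₃` (`exists_bundle_gadget`). One deletion pays for two cuts at
once.

Each ordered pair `(p, q)` of variables gets a chain of `N²` soft equalities falling from 1 to 0;
its cut at `i * N + j` means `p = i`, `q = j`. A second chain rises from 0 to 1 and supplies the
complements. The weights decrease along the one and increase along the other, so that the cheapest
choice is one cut of each chain at a common position, and all positions cost the same
(`le_chainCost`). Chain weights carry a factor `K² + 1`, so the `K²` units reserved for bundles
cannot pay for a deviation. A bundle joins the link `i * N + j` of `(p, q)` to the link `j * N + i`
of `(q, p)`. With one unit per pair, both cuts must lie in the same bundle, so the two chains code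
the same values; for forbidden values the links cannot be cut. Selector variables make all chains of
`p` agree on its value. This is `Gadgets.hardInst_yes_of_solution` and
`Gadgets.exists_solution_of_hardInst_yes`.

For weighted satisfiability, list the true variables increasingly. A false literal is recognized
from at most two entries of this list, hence a false `d`-clause from `2d` entries. So take the
`2d`-tuples of positions as variables, the partial lists as values, and demand pairwise consistency
(`exists_satisfying_iff`).

The time bound comes from closure properties of `PolyTime`, above all `PolyTime.foldl_of_bound`;
`PolyTime.fpt_of_unary` allows `k` to be treated as written in unary. -/

/-! ## Running times -/

/-- The program `p` transforms `x` into `y` within time `T`. -/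
def RunsIn (p : Prog) (x y : Data) (T : ℕ) : Prop := ∃ t ≤ T, Runs p x y t

theorem Data.one_le_size (x : Data) : 1 ≤ x.size := by
  cases x <;> simp [Data.size]

theorem Runs.size_le {p : Prog} {x y : Data} {t : ℕ} (h : Runs p x y t) :
    x.size ≤ t ∧ y.size ≤ t := by
  induction h with
  | instr i x => omega
  | seq _ _ h₁ h₂ => omega
  | pair _ _ h₁ h₂ => simp only [Data.size]; omega
  | ite_true _ _ _ h₁ h₂ => omega
  | ite_false _ _ h₁ h₂ => omega
  | loop_stop _ h => omega
  | loop_step _ _ _ _ h₁ h₂ h₃ => omega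

namespace RunsIn

variable {p q c : Prog} {x y z b : Data} {S T U : ℕ}

theorem mono (h : RunsIn p x y S) (hST : S ≤ T) : RunsIn p x y T :=
  let ⟨t, ht, hr⟩ := h
  ⟨t, ht.trans hST, hr⟩

theorem size_le (h : RunsIn p x y T) : y.size ≤ T :=
  let ⟨_, ht, hr⟩ := h
  hr.size_le.2.trans ht

theorem instr {i : Instr} (h : i.apply x = y) : RunsIn (.instr i) x y (x.size + y.size) := by
  subst h
  exact ⟨_, le_rfl, Runs.instr i x⟩

theorem seq (h₁ : RunsIn p x y S) (h₂ : RunsIn q y z T) : RunsIn (.seq p q) x z (S + T + 1) := by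
  obtain ⟨s, hs, h₁⟩ := h₁
  obtain ⟨t, ht, h₂⟩ := h₂
  exact ⟨_, by omega, Runs.seq h₁ h₂⟩

theorem pair (h₁ : RunsIn p x y S) (h₂ : RunsIn q x z T) :
    RunsIn (.pair p q) x (.pair y z) (S + T + 1) := by
  obtain ⟨s, hs, h₁⟩ := h₁
  obtain ⟨t, ht, h₂⟩ := h₂
  exact ⟨_, by omega, Runs.pair h₁ h₂⟩

theorem ite_true (h₁ : RunsIn c x b S) (hb : b ≠ .num 0) (h₂ : RunsIn p x y T) :
    RunsIn (.ite c p q) x y (S + T + 1) := by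
  obtain ⟨s, hs, h₁⟩ := h₁
  obtain ⟨t, ht, h₂⟩ := h₂
  exact ⟨_, by omega, Runs.ite_true h₁ hb h₂⟩

theorem ite_false (h₁ : RunsIn c x (.num 0) S) (h₂ : RunsIn q x y T) :
    RunsIn (.ite c p q) x y (S + T + 1) := by
  obtain ⟨s, hs, h₁⟩ := h₁
  obtain ⟨t, ht, h₂⟩ := h₂
  exact ⟨_, by omega, Runs.ite_false h₁ h₂⟩

theorem loop_stop (h : RunsIn c x (.num 0) S) : RunsIn (.loop c p) x x (S + 1) := by
  obtain ⟨s, hs, h⟩ := h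
  exact ⟨_, by omega, Runs.loop_stop h⟩

theorem loop_step (h₁ : RunsIn c x b S) (hb : b ≠ .num 0) (h₂ : RunsIn p x y T)
    (h₃ : RunsIn (.loop c p) y z U) : RunsIn (.loop c p) x z (S + T + U + 1) := by
  obtain ⟨s, hs, h₁⟩ := h₁
  obtain ⟨t, ht, h₂⟩ := h₂
  obtain ⟨u, hu, h₃⟩ := h₃
  exact ⟨_, by omega, Runs.loop_step h₁ hb h₂ h₃⟩

theorem fst : RunsIn (.instr .fst) (.pair x y) x (2 * (Data.pair x y).size) :=
  (instr (y := x) rfl).mono (by simp only [Data.size]; omega)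

theorem snd : RunsIn (.instr .snd) (.pair x y) y (2 * (Data.pair x y).size) :=
  (instr (y := y) rfl).mono (by simp only [Data.size]; omega)

end RunsIn

/-! ## Functions computable in polynomial time -/

theorem Polynomial.eval_nat_mono (T : Polynomial ℕ) {m n : ℕ} (h : m ≤ n) :
    T.eval m ≤ T.eval n := by
  induction T using Polynomial.induction_on' with
  | add p q hp hq => simpa using Nat.add_le_add hp hq
  | monomial k a => simpa using Nat.mul_le_mul_left a (Nat.pow_le_pow_left h k)

open DataEnc (enc)

/-- The size of the code of `x`. -/
def codeSize {α : Type} [DataEnc α] (x : α) : ℕ := (enc x).size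

/-- `f` is computed by a program in polynomial time. -/
@[fun_prop]
def PolyTime {α β : Type} [DataEnc α] [DataEnc β] (f : α → β) : Prop :=
  ∃ (p : Prog) (T : Polynomial ℕ), ∀ x, RunsIn p (enc x) (enc (f x)) (T.eval (codeSize x))

section Size

variable {α β : Type} [DataEnc α] [DataEnc β]

theorem one_le_codeSize (x : α) : 1 ≤ codeSize x := Data.one_le_size _

theorem codeSize_pair (x : α) (y : β) : codeSize (x, y) = codeSize x + codeSize y + 1 := rfl

theorem codeSize_nil : codeSize ([] : List α) = 1 := rfl

theorem codeSize_cons (a : α) (l : List α) :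
    codeSize (a :: l) = codeSize a + codeSize l + 1 := rfl

theorem codeSize_append (l m : List α) :
    codeSize (l ++ m) + 1 = codeSize l + codeSize m := by
  induction l with
  | nil => simp [codeSize_nil]; omega
  | cons a l ih => simp only [List.cons_append, codeSize_cons]; omega

theorem length_lt_codeSize (l : List α) : l.length < codeSize l := by
  induction l with
  | nil => simp [codeSize_nil]
  | cons a l ih => simp only [List.length_cons, codeSize_cons]; omega

theorem codeSize_le_of_mem {a : α} {l : List α} (h : a ∈ l) : codeSize a ≤ codeSize l := by
  induction l with
  | nil => simp at h
  | cons b l ih =>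
    rw [codeSize_cons]
    rcases List.mem_cons.1 h with rfl | h
    · omega
    · have := ih h; omega

theorem codeSize_nat (n : ℕ) : codeSize n = Nat.size n + 1 := rfl

theorem codeSize_nat_le (n : ℕ) : codeSize n ≤ n + 1 := by
  rw [codeSize_nat]
  have : Nat.size n ≤ n := Nat.size_le.2 Nat.lt_two_pow_self
  omega

theorem codeSize_bool_le (b : Bool) : codeSize b ≤ 2 := by
  cases b
  · exact codeSize_nat_le 0 |>.trans (by omega)
  · exact codeSize_nat_le 1

end Size

namespace PolyTime

variable {α β γ δ : Type} [DataEnc α] [DataEnc β] [DataEnc γ] [DataEnc δ]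

theorem of_instr (f : α → β) (i : Instr) (h : ∀ x, i.apply (enc x) = enc (f x))
    (T : Polynomial ℕ) (hT : ∀ x, codeSize (f x) ≤ T.eval (codeSize x)) : PolyTime f :=
  ⟨.instr i, .X + T, fun x => (RunsIn.instr (h x)).mono (by simpa [codeSize] using hT x)⟩

@[fun_prop]
theorem id : PolyTime (fun x : α => x) :=
  of_instr _ .id (fun _ => rfl) .X (by simp)

@[fun_prop]
theorem const (b : β) : PolyTime (fun _ : α => b) :=
  of_instr _ (.const (enc b)) (fun _ => rfl) (.C (codeSize b)) (by simp)

@[fun_prop]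
theorem comp {g : β → γ} {f : α → β} (hg : PolyTime g) (hf : PolyTime f) :
    PolyTime (fun x => g (f x)) := by
  obtain ⟨p, S, hp⟩ := hf
  obtain ⟨q, T, hq⟩ := hg
  refine ⟨.seq p q, S + T.comp S + 1, fun x => ((hp x).seq (hq (f x))).mono ?_⟩
  have := T.eval_nat_mono (hp x).size_le
  simp only [Polynomial.eval_add, Polynomial.eval_comp, Polynomial.eval_one]
  simp only [codeSize] at *
  omega

@[fun_prop]
theorem prodMk {f : α → β} {g : α → γ} (hf : PolyTime f) (hg : PolyTime g) :
    PolyTime (fun x => (f x, g x)) := by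
  obtain ⟨p, S, hp⟩ := hf
  obtain ⟨q, T, hq⟩ := hg
  exact ⟨.pair p q, S + T + 1, fun x => ((hp x).pair (hq x)).mono (by simp)⟩

theorem prod_fst : PolyTime (Prod.fst : α × β → α) :=
  of_instr _ .fst (fun _ => rfl) .X (fun ⟨x, y⟩ => by simp [codeSize_pair]; omega)

theorem prod_snd : PolyTime (Prod.snd : α × β → β) :=
  of_instr _ .snd (fun _ => rfl) .X (fun ⟨x, y⟩ => by simp [codeSize_pair]; omega)

@[fun_prop]
theorem fst {f : α → β × γ} (hf : PolyTime f) : PolyTime (fun x => (f x).1) := prod_fst.comp hf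

@[fun_prop]
theorem snd {f : α → β × γ} (hf : PolyTime f) : PolyTime (fun x => (f x).2) := prod_snd.comp hf

theorem nat_add : PolyTime (fun x : ℕ × ℕ => x.1 + x.2) := by
  refine of_instr _ .add (fun _ => rfl) .X fun ⟨m, n⟩ => ?_
  simp only [codeSize_pair, codeSize_nat, Polynomial.eval_X]
  have hm := Nat.lt_size_self m
  have hn := Nat.lt_size_self n
  have : Nat.size (m + n) ≤ Nat.size m + Nat.size n + 1 := by
    rw [Nat.size_le]
    calc m + n < 2 ^ m.size + 2 ^ n.size := by omega
      _ ≤ 2 ^ (m.size + n.size) + 2 ^ (m.size + n.size) :=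
        Nat.add_le_add (Nat.pow_le_pow_right (by omega) (by omega))
          (Nat.pow_le_pow_right (by omega) (by omega))
      _ = 2 ^ (m.size + n.size + 1) := by ring
  omega

theorem nat_mul : PolyTime (fun x : ℕ × ℕ => x.1 * x.2) := by
  refine of_instr _ .mul (fun _ => rfl) .X fun ⟨m, n⟩ => ?_
  simp only [codeSize_pair, codeSize_nat, Polynomial.eval_X]
  have hm := Nat.lt_size_self m
  have hn := Nat.lt_size_self n
  have : Nat.size (m * n) ≤ Nat.size m + Nat.size n := by
    rw [Nat.size_le, pow_add]
    exact Nat.mul_lt_mul'' hm hn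
  omega

theorem nat_sub : PolyTime (fun x : ℕ × ℕ => x.1 - x.2) := by
  refine of_instr _ .sub (fun _ => rfl) .X fun ⟨m, n⟩ => ?_
  simp only [codeSize_pair, codeSize_nat, Polynomial.eval_X]
  have : Nat.size (m - n) ≤ Nat.size m := Nat.size_le_size (Nat.sub_le m n)
  omega

@[fun_prop]
theorem add {f g : α → ℕ} (hf : PolyTime f) (hg : PolyTime g) :
    PolyTime (fun x => f x + g x) := nat_add.comp (hf.prodMk hg)

@[fun_prop]
theorem mul {f g : α → ℕ} (hf : PolyTime f) (hg : PolyTime g) :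
    PolyTime (fun x => f x * g x) := nat_mul.comp (hf.prodMk hg)

@[fun_prop]
theorem sub {f g : α → ℕ} (hf : PolyTime f) (hg : PolyTime g) :
    PolyTime (fun x => f x - g x) := nat_sub.comp (hf.prodMk hg)

theorem prod_eq [DecidableEq β] : PolyTime (fun x : β × β => decide (x.1 = x.2)) := by
  refine of_instr _ .eq (fun x => ?_) 2 (fun x => by simpa using codeSize_bool_le _)
  change Data.num (if enc x.1 = enc x.2 then 1 else 0) = Data.num _
  by_cases h : x.1 = x.2
  · simp [h]
  · have : enc x.1 ≠ enc x.2 := fun h' => h (DataEnc.enc_injective h')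
    simp [h, this]

@[fun_prop]
theorem decide_eq [DecidableEq β] {f g : α → β} (hf : PolyTime f) (hg : PolyTime g) :
    PolyTime (fun x => decide (f x = g x)) := prod_eq.comp (hf.prodMk hg)

theorem prod_le : PolyTime (fun x : ℕ × ℕ => decide (x.1 ≤ x.2)) := by
  refine of_instr _ .le (fun x => ?_) 2 (fun x => by simpa using codeSize_bool_le _)
  change Data.num (if x.1 ≤ x.2 then 1 else 0) = Data.num _
  by_cases h : x.1 ≤ x.2 <;> simp [h]

@[fun_prop]
theorem decide_le {f g : α → ℕ} (hf : PolyTime f) (hg : PolyTime g) :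
    PolyTime (fun x => decide (f x ≤ g x)) := prod_le.comp (hf.prodMk hg)

@[fun_prop]
theorem cond {c : α → Bool} {f g : α → β} (hc : PolyTime c) (hf : PolyTime f)
    (hg : PolyTime g) : PolyTime (fun x => bif c x then f x else g x) := by
  obtain ⟨r, U, hr⟩ := hc
  obtain ⟨p, S, hp⟩ := hf
  obtain ⟨q, T, hq⟩ := hg
  refine ⟨.ite r p q, U + (S + T) + 1, fun x => ?_⟩
  have := hr x
  cases h : c x
  · rw [h] at this
    simp only [h, cond_false]
    refine (RunsIn.ite_false (p := p) this (hq x)).mono ?_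
    simp only [Polynomial.eval_add, Polynomial.eval_one]
    omega
  · rw [h] at this
    simp only [h, cond_true]
    refine (RunsIn.ite_true (q := q) this (by simp [enc]) (hp x)).mono ?_
    simp only [Polynomial.eval_add, Polynomial.eval_one]
    omega

@[fun_prop]
theorem and {f g : α → Bool} (hf : PolyTime f) (hg : PolyTime g) :
    PolyTime (fun x => f x && g x) := by
  have : (fun x => f x && g x) = fun x => bif f x then g x else false := by
    funext x; cases f x <;> rfl
  rw [this]; fun_prop

@[fun_prop]
theorem or {f g : α → Bool} (hf : PolyTime f) (hg : PolyTime g) :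
    PolyTime (fun x => f x || g x) := by
  have : (fun x => f x || g x) = fun x => bif f x then true else g x := by
    funext x; cases f x <;> rfl
  rw [this]; fun_prop

@[fun_prop]
theorem not {f : α → Bool} (hf : PolyTime f) : PolyTime (fun x => !f x) := by
  have : (fun x => !f x) = fun x => bif f x then false else true := by
    funext x; cases f x <;> rfl
  rw [this]; fun_prop

@[fun_prop]
theorem cons {f : α → β} {l : α → List β} (hf : PolyTime f) (hl : PolyTime l) :
    PolyTime (fun x => f x :: l x) := by
  obtain ⟨p, T, h⟩ := hf.prodMk hl
  exact ⟨p, T, h⟩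

end PolyTime

/-! ### Iteration over lists with bounded intermediate results. -/

namespace PolyTime

variable {α β γ δ : Type} [DataEnc α] [DataEnc β] [DataEnc γ] [DataEnc δ]

/-- Iteration over a list, provided that the intermediate results stay of polynomial size. -/
theorem foldl_of_bound {l : α → List β} {f : α → γ → β → γ} {i : α → γ} (hl : PolyTime l)
    (hf : PolyTime (fun x : α × β × γ => f x.1 x.2.2 x.2.1)) (hi : PolyTime i)
    (Q : Polynomial ℕ)
    (hQ : ∀ x l₁ l₂, l x = l₁ ++ l₂ → codeSize (l₁.foldl (f x) (i x)) ≤ Q.eval (codeSize x)) :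
    PolyTime (fun x => (l x).foldl (f x) (i x)) := by
  obtain ⟨pl, Tl, hpl⟩ := hl
  obtain ⟨pf, Tf, hpf⟩ := hf
  obtain ⟨pi, Ti, hpi⟩ := hi
  -- The state of the loop is (input, remaining list, accumulator). The test returns the remaining
  -- list, whose code is `0` exactly when it is empty.
  let sf : Prog := .instr .fst
  let ss : Prog := .instr .snd
  let body : Prog := .pair sf (.pair (.seq (.seq ss sf) ss)
    (.seq (.pair sf (.pair (.seq (.seq ss sf) sf) (.seq ss ss))) pf))
  -- `B` bounds the sizes that occur and `F` the time of one call of `pf`; `60 * B + 60` is a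
  -- generous allowance for the projections and pairings of one round.
  have main : ∀ (x : α) (B F : ℕ),
      (∀ b c, codeSize (b : β) ≤ B → codeSize (c : γ) ≤ B →
        RunsIn pf (enc (x, b, c)) (enc (f x c b)) F) →
      ∀ (l : List β) (c : γ), codeSize x + codeSize l ≤ B →
      (∀ l₁ l₂, l = l₁ ++ l₂ → codeSize (l₁.foldl (f x) c) ≤ B) →
      RunsIn (.loop (.seq ss sf) body) (enc (x, l, c)) (enc (x, ([] : List β), l.foldl (f x) c))
        ((l.length + 1) * (F + 60 * B + 60)) := by
    intro x B F hF l
    induction l with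
    | nil =>
      intro c hB hc
      have hc0 := hc [] [] rfl
      simp only [List.foldl_nil] at hc0
      refine (RunsIn.loop_stop (RunsIn.seq RunsIn.snd RunsIn.fst)).mono ?_
      simp only [codeSize] at hB hc0
      simp only [Data.size]
      simp
      omega
    | cons b l ih =>
      intro c hB hc
      have hc0 := hc [] _ rfl
      have hc1 := hc [b] _ rfl
      rw [codeSize_cons] at hB
      have ih := ih (f x c b) (by omega) (fun l₁ l₂ h => hc (b :: l₁) l₂ (by rw [h]; rfl))
      simp only [List.foldl_nil, List.foldl_cons] at hc0 hc1
      have hb := hF b c (by omega) hc0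
      have hlist : enc (b :: l) = .pair (enc b) (enc l) := rfl
      have hst : enc (x, b :: l, c) = .pair (enc x) (.pair (.pair (enc b) (enc l)) (enc c)) := rfl
      have hst' : enc (x, b, c) = .pair (enc x) (.pair (enc b) (enc c)) := rfl
      have hbody : RunsIn body (enc (x, b :: l, c)) (enc (x, l, f x c b)) (F + 50 * B + 50) := by
        rw [hst'] at hb
        rw [hst]
        refine (RunsIn.pair RunsIn.fst (RunsIn.pair
          (RunsIn.seq (RunsIn.seq RunsIn.snd RunsIn.fst) RunsIn.snd)
          (RunsIn.seq (RunsIn.pair RunsIn.fst (RunsIn.pair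
            (RunsIn.seq (RunsIn.seq RunsIn.snd RunsIn.fst) RunsIn.fst)
            (RunsIn.seq RunsIn.snd RunsIn.snd))) hb))).mono ?_
        simp only [codeSize] at hB hc0
        simp only [Data.size]
        omega
      refine (RunsIn.loop_step (b := enc (b :: l)) (RunsIn.seq RunsIn.snd RunsIn.fst)
        (by rw [hlist]; simp) hbody ih).mono ?_
      have : (l.length + 1 + 1) * (F + 60 * B + 60)
        = (l.length + 1) * (F + 60 * B + 60) + (F + 60 * B + 60) := by ring
      rw [List.length_cons, this]
      simp only [codeSize] at hB hc0
      simp only [Data.size, hlist]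
      omega
  let B : Polynomial ℕ := .X + Tl + Q
  refine ⟨.seq (.seq (.pair (.instr .id) (.pair pl pi)) (.loop (.seq ss sf) body)) (.seq ss ss),
    (.X + .X + (Tl + Ti + 1) + 1) + ((Tl + 1) * (Tf.comp (.X + B + B + 2) + 60 * B + 60)) + 1
      + (20 * B + 20) + 1, fun x => ?_⟩
  have hsl : codeSize (l x) ≤ Tl.eval (codeSize x) := (hpl x).size_le
  have hlen := length_lt_codeSize (l x)
  have hB : B.eval (codeSize x) =
    codeSize x + Tl.eval (codeSize x) + Q.eval (codeSize x) := by simp [B]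
  have hfin := hQ x (l x) [] (by simp)
  have hloop := main x (B.eval (codeSize x))
    (Tf.eval (codeSize x + B.eval (codeSize x) + B.eval (codeSize x) + 2))
    (fun b c hb hc => (hpf (x, b, c)).mono (Tf.eval_nat_mono (by
      simp only [codeSize_pair]; omega))) (l x) (i x) (by omega)
    (fun l₁ l₂ h => (hQ x l₁ l₂ h).trans (by omega))
  have h₁ : RunsIn (.instr .id) (enc x) (enc x) (codeSize x + codeSize x) := RunsIn.instr rfl
  have h₃ : RunsIn (.seq ss ss) (enc (x, ([] : List β), (l x).foldl (f x) (i x)))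
      (enc ((l x).foldl (f x) (i x))) (20 * B.eval (codeSize x) + 20) := by
    refine (RunsIn.seq RunsIn.snd RunsIn.snd).mono ?_
    have : (enc ([] : List β)).size = 1 := rfl
    simp only [codeSize] at hB hfin
    simp only [Data.size, codeSize, this]
    omega
  have hmul := Nat.mul_le_mul_right (Tf.eval (codeSize x + B.eval (codeSize x) +
    B.eval (codeSize x) + 2) + 60 * B.eval (codeSize x) + 60)
    (show (l x).length + 1 ≤ Tl.eval (codeSize x) + 1 by omega)
  refine (((h₁.pair ((hpl x).pair (hpi x))).seq hloop).seq h₃).mono ?_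
  simp only [Polynomial.eval_add, Polynomial.eval_mul, Polynomial.eval_comp, Polynomial.eval_X,
    Polynomial.eval_one, Polynomial.eval_ofNat]
  omega

/-- A left fold builds lists in reverse; two reversals yield concatenation. -/
theorem list_revAppend : PolyTime (fun x : List α × List α => x.1.foldl (fun s a => a :: s) x.2) := by
  refine foldl_of_bound (f := fun _ s a => a :: s) prod_fst (by fun_prop) prod_snd .X ?_
  rintro ⟨l, m⟩ l₁ l₂ h
  have key : ∀ (l m : List α), codeSize (l.foldl (fun s a => a :: s) m) + 1
      = codeSize l + codeSize m := by
    intro l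
    induction l with
    | nil => intro m; simp [codeSize_nil]; omega
    | cons a l ih => intro m; simp only [List.foldl_cons, ih, codeSize_cons]; omega
  have h₁ := key l₁ m
  have h₂ := codeSize_append l₁ l₂
  have h₃ := one_le_codeSize l₂
  simp only at h
  simp only [codeSize_pair, h, Polynomial.eval_X]
  omega

theorem list_append : PolyTime (fun x : List α × List α => x.1 ++ x.2) := by
  have := list_revAppend.comp ((list_revAppend.comp (prod_fst.prodMk (const []))).prodMk
    (prod_snd (α := List α) (β := List α)))
  convert this using 2 with x
  simp [List.foldl_flip_cons_eq_append]

@[fun_prop]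
theorem append {f g : α → List β} (hf : PolyTime f) (hg : PolyTime g) :
    PolyTime (fun x => f x ++ g x) := list_append.comp (hf.prodMk hg)

/-- Polynomial-time functions have values of polynomial size. -/
theorem codeSize_bound {f : α → β} (hf : PolyTime f) :
    ∃ T : Polynomial ℕ, ∀ x, codeSize (f x) ≤ T.eval (codeSize x) :=
  let ⟨_, T, h⟩ := hf
  ⟨T, fun x => (h x).size_le⟩

@[fun_prop]
theorem flatMap {l : α → List β} {g : α → β → List γ} (hl : PolyTime l)
    (hg : PolyTime (fun x : α × β => g x.1 x.2)) : PolyTime (fun x => (l x).flatMap (g x)) := by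
  obtain ⟨Tl, hTl⟩ := hl.codeSize_bound
  obtain ⟨Tg, hTg⟩ := hg.codeSize_bound
  have := foldl_of_bound (f := fun x s b => s ++ g x b) (i := fun _ => []) hl
    (by fun_prop) (const _) (Tl * Tg.comp (.X + Tl + 1) + 1) (by
      intro x l₁ l₂ h
      have hsize : ∀ b ∈ l₁, codeSize (g x b) ≤ Tg.eval (codeSize x + Tl.eval (codeSize x) + 1) := by
        intro b hb
        refine (hTg (x, b)).trans (Tg.eval_nat_mono ?_)
        have := codeSize_le_of_mem (l := l x) (a := b) (by simp [h, hb])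
        have := hTl x
        simp only [codeSize_pair]; omega
      have key : ∀ (m : List β) (s : List γ), (∀ b ∈ m, b ∈ l₁) →
          codeSize (m.foldl (fun s b => s ++ g x b) s) ≤
          codeSize s + m.length * Tg.eval (codeSize x + Tl.eval (codeSize x) + 1) := by
        intro m
        induction m with
        | nil => intro s _; simp
        | cons b m ih =>
          intro s hm
          refine (ih _ fun b hb => hm b (by simp [hb])).trans ?_
          have h₁ := codeSize_append s (g x b)
          have h₂ := hsize b (hm b (by simp))
          rw [List.length_cons, Nat.succ_mul]
          beta_reduce
          omega
      refine (key l₁ [] (fun _ h => h)).trans ?_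
      have h₁ : l₁.length ≤ Tl.eval (codeSize x) := by
        have h₁ := length_lt_codeSize (l x)
        have h₂ := hTl x
        rw [h, List.length_append] at h₁
        rw [h] at h₂
        omega
      have h₂ := Nat.mul_le_mul_right (Tg.eval (codeSize x + Tl.eval (codeSize x) + 1)) h₁
      simp only [codeSize_nil, Polynomial.eval_add, Polynomial.eval_mul, Polynomial.eval_comp,
        Polynomial.eval_X, Polynomial.eval_one]
      omega)
  convert this using 2 with x
  rw [List.foldl_append_eq_append]; rfl

@[fun_prop]
theorem map {l : α → List β} {g : α → β → γ} (hl : PolyTime l)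
    (hg : PolyTime (fun x : α × β => g x.1 x.2)) : PolyTime (fun x => (l x).map (g x)) := by
  have : (fun x => (l x).map (g x)) = fun x => (l x).flatMap fun b => [g x b] := by
    funext x; exact List.map_eq_flatMap
  rw [this]; fun_prop

@[fun_prop]
theorem all {l : α → List β} {g : α → β → Bool} (hl : PolyTime l)
    (hg : PolyTime (fun x : α × β => g x.1 x.2)) : PolyTime (fun x => (l x).all (g x)) := by
  have := foldl_of_bound (f := fun x s b => s && g x b) (i := fun _ => true) hl
    (by fun_prop) (const _) 2 (fun x l₁ _ _ => by simpa using codeSize_bool_le _)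
  convert this using 2 with x
  have key : ∀ (m : List β) (s : Bool), m.foldl (fun s b => s && g x b) s = (s && m.all (g x)) := by
    intro m
    induction m with
    | nil => simp
    | cons b m ih => intro s; simp [ih, Bool.and_assoc]
  simp [key]

@[fun_prop]
theorem any {l : α → List β} {g : α → β → Bool} (hl : PolyTime l)
    (hg : PolyTime (fun x : α × β => g x.1 x.2)) : PolyTime (fun x => (l x).any (g x)) := by
  have : (fun x => (l x).any (g x)) = fun x => !((l x).all fun b => !(g x b)) := by
    funext x; simp [List.all_eq_not_any_not]
  rw [this]; fun_prop

@[fun_prop]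
theorem length {l : α → List β} (hl : PolyTime l) : PolyTime (fun x => (l x).length) := by
  obtain ⟨Tl, hTl⟩ := hl.codeSize_bound
  have key : ∀ (m : List β) (s : ℕ), m.foldl (fun s _ => s + 1) s = s + m.length := by
    intro m
    induction m with
    | nil => simp
    | cons b m ih => intro s; simp only [List.foldl_cons, ih, List.length_cons]; omega
  have := foldl_of_bound (f := fun _ s _ => s + 1) (i := fun _ => 0) hl
    (by fun_prop) (const _) Tl (by
      intro x l₁ l₂ h
      have h₁ := length_lt_codeSize (l x)
      have h₂ := hTl x
      have h₃ := codeSize_nat_le l₁.length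
      rw [key, Nat.zero_add]
      rw [h, List.length_append] at h₁
      rw [h] at h₂
      omega)
  simpa only [key, Nat.zero_add] using this

@[fun_prop]
theorem zipIdx {l : α → List β} (hl : PolyTime l) : PolyTime (fun x => (l x).zipIdx) := by
  obtain ⟨Tl, hTl⟩ := hl.codeSize_bound
  have key : ∀ (m : List β) (s : List (β × ℕ)),
      m.foldl (fun s b => s ++ [(b, s.length)]) s = s ++ m.zipIdx s.length := by
    intro m
    induction m with
    | nil => simp
    | cons b m ih => intro s; simp [ih, List.zipIdx_cons]
  have size : ∀ (m : List β) (n : ℕ), codeSize (m.zipIdx n) ≤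
      codeSize m + m.length * (m.length + n + 3) := by
    intro m
    induction m with
    | nil => simp [codeSize_nil]
    | cons b m ih =>
      intro n
      have h₁ := codeSize_nat_le n
      have h₂ := ih (n + 1)
      simp only [List.zipIdx_cons, codeSize_cons, codeSize_pair, List.length_cons]
      nlinarith
  have := foldl_of_bound (f := fun _ s b => s ++ [(b, s.length)]) (i := fun _ => []) hl
    (by fun_prop) (const _) (Tl + Tl * (Tl + 3)) (by
      intro x l₁ l₂ h
      have h₁ := length_lt_codeSize (l x)
      have h₂ := hTl x
      rw [key, List.nil_append]
      have h₃ := size l₁ 0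
      have h₄ := codeSize_append l₁ l₂
      have h₅ := one_le_codeSize l₂
      rw [h, List.length_append] at h₁
      rw [h] at h₂
      simp only [Polynomial.eval_add, Polynomial.eval_mul, Polynomial.eval_ofNat,
        List.length_nil] at *
      nlinarith)
  simpa only [key, List.nil_append, List.length_nil] using this

-- A number can be exponentially larger than its binary code, so listing the numbers below it is not
-- polynomial in general. Polynomial time of `List.range (n x)` is therefore used below as the
-- hypothesis that `n` is computable and of polynomial value.
@[fun_prop]
theorem range_length {l : α → List β} (hl : PolyTime l) :
    PolyTime (fun x => List.range (l x).length) := by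
  have : (fun x => List.range (l x).length) = fun x => (l x).zipIdx.map fun b => b.2 := by
    funext x; simp [List.range_eq_range']
  rw [this]; fun_prop

theorem ofFn {n : ℕ} {f : α → Fin n → β} (hf : ∀ i, PolyTime (fun x => f x i)) :
    PolyTime (fun x => List.ofFn (f x)) := by
  induction n with
  | zero => simpa using const _
  | succ n ih =>
    simp only [List.ofFn_succ]
    exact (hf 0).cons (ih fun i => hf i.succ)

end PolyTime

/-! ## Parameterized reductions -/

theorem Polynomial.computable_eval_nat (T : Polynomial ℕ) : Computable (fun n : ℕ => T.eval n) := by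
  refine Primrec.to_comp ?_
  induction T using Polynomial.induction_on' with
  | add p q hp hq => simpa using Primrec.nat_add.comp hp hq
  | monomial k a =>
    have hpow : Primrec fun n : ℕ => n ^ k := by
      induction k with
      | zero => simpa using Primrec.const 1
      | succ k ih => exact (Primrec.nat_mul.comp ih Primrec.id).of_eq fun n => (pow_succ n k).symm
    simpa using Primrec.nat_mul.comp (Primrec.const a) hpow

/-- Separates the parameter from the size: a polynomial bound in `k * n` takes the form `f(k) * n ^
c`. -/
theorem Polynomial.eval_nat_mul_le (T : Polynomial ℕ) :
    ∃ c : ℕ, ∀ m n : ℕ, 1 ≤ n → T.eval (m * n) ≤ T.eval m * n ^ c := by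
  induction T using Polynomial.induction_on' with
  | add p q hp hq =>
    obtain ⟨a, ha⟩ := hp
    obtain ⟨b, hb⟩ := hq
    refine ⟨max a b, fun m n hn => ?_⟩
    rw [Polynomial.eval_add, Polynomial.eval_add, add_mul]
    exact Nat.add_le_add
      ((ha m n hn).trans (Nat.mul_le_mul_left _ (Nat.pow_le_pow_right hn (le_max_left _ _))))
      ((hb m n hn).trans (Nat.mul_le_mul_left _ (Nat.pow_le_pow_right hn (le_max_right _ _))))
  | monomial k a =>
    refine ⟨k, fun m n _ => ?_⟩
    simp only [Polynomial.eval_monomial]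
    rw [mul_pow, mul_assoc]

/-- In a composition of reductions, the second bound is evaluated at a parameter that is only known
up to an upper bound, so it has to be monotone. Partial sums provide such a majorant. -/
theorem Computable.exists_monotone_ge {f : ℕ → ℕ} (hf : Computable f) :
    ∃ F : ℕ → ℕ, Computable F ∧ Monotone F ∧ ∀ n, f n ≤ F n := by
  let F : ℕ → ℕ := fun n => Nat.rec (f 0) (fun m s => s + f (m + 1)) n
  have hF : ∀ n, F (n + 1) = F n + f (n + 1) := fun n => rfl
  refine ⟨F, ?_, monotone_nat_of_le_succ fun n => by rw [hF]; omega, fun n => ?_⟩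
  · refine Computable.nat_rec (f := fun n : ℕ => n) (g := fun _ => f 0)
      (h := fun (_ : ℕ) (p : ℕ × ℕ) => p.2 + f (p.1 + 1)) Computable.id (Computable.const _) ?_
    have h₁ : Computable fun p : ℕ × ℕ × ℕ => p.2.2 := Computable.snd.comp Computable.snd
    have h₂ : Computable fun p : ℕ × ℕ × ℕ => f (p.2.1 + 1) :=
      hf.comp (Computable.succ.comp (Computable.fst.comp Computable.snd))
    exact Primrec.nat_add.to_comp.comp h₁ h₂
  · cases n with
    | zero => exact le_rfl
    | succ n => rw [hF]; omega

namespace ParamProblem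

theorem FPTReducible.trans {P Q R : ParamProblem} (h₁ : P.FPTReducible Q)
    (h₂ : Q.FPTReducible R) : P.FPTReducible R := by
  obtain ⟨r, p, f, g, c, hf, hg, h⟩ := h₁
  obtain ⟨r', p', f', g', c', hf', hg', h'⟩ := h₂
  obtain ⟨F, hF, hFm, hfF⟩ := hf'.exists_monotone_ge
  obtain ⟨G, hG, hGm, hgG⟩ := hg'.exists_monotone_ge
  have hpow : Computable fun k : ℕ => f k ^ c' := by
    have := (Polynomial.X ^ c' : Polynomial ℕ).computable_eval_nat.comp hf
    simpa using this
  have hmul : Computable₂ ((· * ·) : ℕ → ℕ → ℕ) := Primrec.nat_mul.to_comp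
  have hadd : Computable₂ ((· + ·) : ℕ → ℕ → ℕ) := Primrec.nat_add.to_comp
  refine ⟨r' ∘ r, .seq p p', fun k => f k + F (g k) * f k ^ c' + 1, G ∘ g, c + c * c',
    hadd.comp (hadd.comp hf (hmul.comp (hF.comp hg) hpow)) (Computable.const 1),
    hG.comp hg, fun x => ?_⟩
  obtain ⟨hyes, hpar, t, hrun, ht⟩ := h x
  obtain ⟨hyes', hpar', t', hrun', ht'⟩ := h' (r x)
  refine ⟨hyes.trans hyes', hpar'.trans ((hgG _).trans (hGm hpar)), _, hrun.seq hrun', ?_⟩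
  have hn : 1 ≤ (P.encode x).size := Data.one_le_size _
  set n := (P.encode x).size
  set k := P.param x
  -- The output of the first reduction is no larger than its running time; this bounds the input
  -- size of the second.
  have h₁ : t' ≤ F (g k) * f k ^ c' * n ^ (c * c') :=
    calc t' ≤ f' (Q.param (r x)) * (Q.encode (r x)).size ^ c' := ht'
      _ ≤ F (g k) * (f k * n ^ c) ^ c' :=
        Nat.mul_le_mul ((hfF _).trans (hFm hpar))
          (Nat.pow_le_pow_left (hrun.size_le.2.trans ht) _)
      _ = F (g k) * f k ^ c' * n ^ (c * c') := by rw [mul_pow, ← pow_mul, mul_assoc]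
  have h₂ : n ^ c ≤ n ^ (c + c * c') := Nat.pow_le_pow_right hn (by omega)
  have h₃ : n ^ (c * c') ≤ n ^ (c + c * c') := Nat.pow_le_pow_right hn (by omega)
  have h₄ : 1 ≤ n ^ (c + c * c') := Nat.one_le_pow _ _ hn
  calc t + t' + 1 ≤ f k * n ^ c + F (g k) * f k ^ c' * n ^ (c * c') + 1 := by omega
    _ ≤ f k * n ^ (c + c * c') + F (g k) * f k ^ c' * n ^ (c + c * c') + n ^ (c + c * c') :=
      Nat.add_le_add (Nat.add_le_add (Nat.mul_le_mul_left _ h₂) (Nat.mul_le_mul_left _ h₃)) h₄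
    _ = _ := by ring

end ParamProblem

/-- A polynomial-time function of `x` and of the number `k` in unary can be computed from `x` and
the number `k` in binary in time `f(k) * n ^ c`. -/
theorem PolyTime.fpt_of_unary {α β : Type} [DataEnc α] [DataEnc β] {g : α × List ℕ → β}
    (hg : PolyTime g) :
    ∃ (p : Prog) (f : ℕ → ℕ) (c : ℕ), Computable f ∧ ∀ (x : α) (k : ℕ),
      RunsIn p (enc (x, k)) (enc (g (x, List.replicate k 0))) (f k * codeSize (x, k) ^ c) := by
  obtain ⟨pg, Tg, hpg⟩ := hg
  obtain ⟨pi, Ti, hpi⟩ : PolyTime fun y : α × ℕ => (y.1, y.2, ([] : List ℕ)) := by fun_prop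
  obtain ⟨pt, Tt, hpt⟩ : PolyTime fun y : α × ℕ × List ℕ => y.2.1 := by fun_prop
  -- One round moves one unit from the binary counter to the unary list.
  obtain ⟨pb, Tb, hpb⟩ : PolyTime fun y : α × ℕ × List ℕ => (y.1, y.2.1 - 1, 0 :: y.2.2) := by
    fun_prop
  obtain ⟨pe, Te, hpe⟩ : PolyTime fun y : α × ℕ × List ℕ => (y.1, y.2.2) := by fun_prop
  have size_rep : ∀ k : ℕ, codeSize (List.replicate k 0) = 2 * k + 1 := by
    intro k
    induction k with
    | zero => rfl
    | succ k ih =>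
      rw [List.replicate_succ, codeSize_cons, ih]
      have : codeSize 0 = 1 := rfl
      omega
  have size_st : ∀ (x : α) (i j : ℕ), codeSize (x, i, List.replicate j 0) ≤
      codeSize x + i + 2 * j + 4 := by
    intro x i j
    have := codeSize_nat_le i
    simp only [codeSize_pair, size_rep]; omega
  have main : ∀ (x : α) (B i j : ℕ), codeSize x + 2 * (i + j) + 4 ≤ B →
      RunsIn (.loop pt pb) (enc (x, i, List.replicate j 0))
        (enc (x, 0, List.replicate (i + j) 0)) ((i + 1) * (Tt.eval B + Tb.eval B + 1)) := by
    intro x B i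
    induction i with
    | zero =>
      intro j hB
      have h := hpt (x, 0, List.replicate j 0)
      have h₁ := Tt.eval_nat_mono ((size_st x 0 j).trans (by omega : _ ≤ B))
      rw [Nat.zero_add]
      exact (RunsIn.loop_stop h).mono (by omega)
    | succ i ih =>
      intro j hB
      have h := hpt (x, i + 1, List.replicate j 0)
      have h' := hpb (x, i + 1, List.replicate j 0)
      have hs := (size_st x (i + 1) j).trans (by omega : _ ≤ B)
      have h₁ := Tt.eval_nat_mono hs
      have h₂ := Tb.eval_nat_mono hs
      have hrec := ih (j + 1) (by omega)
      rw [show i + (j + 1) = i + 1 + j by omega] at hrec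
      refine (RunsIn.loop_step h (by simp [enc]) h' hrec).mono ?_
      rw [Nat.succ_mul (i + 1)]
      omega
  -- All states have size at most `(2 * k + 5) * codeSize (x, k)`, and `T` bounds the whole running
  -- time at this size.
  let T : Polynomial ℕ := Ti + (.X + 1) * (Tt + Tb + 1) + Te + Tg + 3
  obtain ⟨c, hc⟩ := T.eval_nat_mul_le
  refine ⟨.seq (.seq (.seq pi (.loop pt pb)) pe) pg, fun k => T.eval (2 * k + 5), c, ?_, fun x k => ?_⟩
  · have := (T.comp (2 * .X + 5)).computable_eval_nat
    simpa [Polynomial.eval_comp] using this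
  · have hn : 1 ≤ codeSize (x, k) := one_le_codeSize _
    refine RunsIn.mono ?_ (hc (2 * k + 5) _ hn)
    have hx : codeSize x ≤ codeSize (x, k) := by rw [codeSize_pair]; omega
    have hB : codeSize x + 2 * k + 4 ≤ (2 * k + 5) * codeSize (x, k) := by nlinarith
    have hB' : codeSize (x, k) ≤ (2 * k + 5) * codeSize (x, k) := by nlinarith
    have hk : k ≤ (2 * k + 5) * codeSize (x, k) := by nlinarith
    set B := (2 * k + 5) * codeSize (x, k)
    have h₁ := main x B k 0 (by omega)
    have h₂ := (hpi (x, k)).seq h₁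
    have h₃ := h₂.seq (hpe (x, 0, List.replicate k 0))
    have h₄ := h₃.seq (hpg (x, List.replicate k 0))
    refine h₄.mono ?_
    have e₁ := Ti.eval_nat_mono hB'
    have e₂ : Te.eval (codeSize (x, 0, List.replicate k 0)) ≤ Te.eval B :=
      Te.eval_nat_mono ((size_st x 0 k).trans (by omega))
    have e₃ : Tg.eval (codeSize (x, List.replicate k 0)) ≤ Tg.eval B :=
      Tg.eval_nat_mono (by rw [codeSize_pair, size_rep]; omega)
    have e₄ := Nat.mul_le_mul_right (Tt.eval B + Tb.eval B + 1) (show k + 1 ≤ B + 1 by omega)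
    simp only [T, Polynomial.eval_add, Polynomial.eval_mul, Polynomial.eval_X,
      Polynomial.eval_one, Polynomial.eval_ofNat]
    omega

/-! ## Gadgets -/

namespace Formula

variable {Γ : ConstraintLang} {V U : Type}

/-- Renaming of the variables of a formula. -/
def rename (ρ : V → U) (F : Formula Γ V) : Formula Γ U :=
  F.map fun C => ⟨C.rel, C.mem, ρ ∘ C.scope⟩

theorem cost_rename (ρ : V → U) (F : Formula Γ V) (α : U → Bool) :
    (F.rename ρ).cost α = F.cost (α ∘ ρ) := by
  simp only [cost, rename, List.countP_map]
  rfl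

theorem cost_append (F F' : Formula Γ V) (α : V → Bool) :
    Formula.cost (F ++ F' : List (Constraint Γ V)) α = F.cost α + F'.cost α :=
  List.countP_append

theorem cost_singleton (C : Constraint Γ V) (α : V → Bool) :
    Formula.cost [C] α = if C.Sat α then 0 else 1 := by
  by_cases h : C.Sat α <;> simp [cost, h]

end Formula

/-- The formulas from which hard instances are built: a soft equality of cost `c`, the clause
`¬ x ∨ ¬ y`, a formula that expresses `o = 1` provided that `z = 0`, and a formula of cost at most
one, on four variables and their complements, that is violated if `x₀ > x₁` or `x₂ > x₃`, and
satisfiable if `x₀ = x₁` and `x₂ = x₃`. -/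
structure Gadgets (Γ : ConstraintLang) where
  c : ℕ
  c_pos : 0 < c
  eqAux : ℕ
  eqF : Formula Γ (Fin 2 ⊕ Fin eqAux)
  eqSol : Bool → Bool → Fin eqAux → Bool
  eq_sol : ∀ s t, eqF.cost (Sum.elim ![s, t] (eqSol s t)) = if s = t then 0 else c
  le_eq : ∀ s t y, s ≠ t → c ≤ eqF.cost (Sum.elim ![s, t] y)
  nandAux : ℕ
  nandF : Formula Γ (Fin 2 ⊕ Fin nandAux)
  nandSol : Bool → Bool → Fin nandAux → Bool
  nand_sol : ∀ s t, (s && t) = false → nandF.cost (Sum.elim ![s, t] (nandSol s t)) = 0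
  le_nand : ∀ y, 1 ≤ nandF.cost (Sum.elim ![true, true] y)
  oneF : Formula Γ (Fin 2)
  one_sol : oneF.cost ![false, true] = 0
  le_one : 1 ≤ oneF.cost ![false, false]
  bunAux : ℕ
  bunF : Formula Γ ((Fin 4 × Bool) ⊕ Fin bunAux)
  bunSol : Bool → Bool → Fin bunAux → Bool
  bun_le_one : ∀ α, bunF.cost α ≤ 1
  bun_sol : ∀ s t, bunF.cost (Sum.elim (fun v => ![s, s, t, t] v.1 == v.2) (bunSol s t)) = 0
  le_bun : ∀ (x : Fin 4 → Bool) y, (x 0 = true ∧ x 1 = false) ∨ (x 2 = true ∧ x 3 = false) →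
    1 ≤ bunF.cost (Sum.elim (fun v => x v.1 == v.2) y)

/-! ### Existence of the gadgets. -/

section Exists

variable {Γ : ConstraintLang}

theorem PropImplements.exists_sol {f : (Fin 2 → Bool) → ℕ} {g : Bool → Bool → ℕ}
    (h : PropImplements Γ f) (hfg : ∀ s t, f ![s, t] = g s t) :
    ∃ (c m : ℕ) (F : Formula Γ (Fin 2 ⊕ Fin m)) (sol : Bool → Bool → Fin m → Bool), 0 < c ∧
      (∀ s t, F.cost (Sum.elim ![s, t] (sol s t)) = c * g s t) ∧
      ∀ s t y, c * g s t ≤ F.cost (Sum.elim ![s, t] y) := by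
  obtain ⟨m, F, c, hc, hF⟩ := h
  choose sol hsol using fun s t : Bool => (hF ![s, t]).1
  refine ⟨c, m, F, sol, hc, fun s t => ?_, fun s t y => ?_⟩
  · rw [← hfg]; exact hsol s t
  · rw [← hfg]; exact (hF ![s, t]).2 ⟨y, rfl⟩

/-- Equality is the conjunction of two opposite implications, at most one of which fails. Two copies
of an implementation of the implication, with disjoint auxiliary variables, thus cost `c` exactly
when the values differ. -/
theorem exists_eq_gadget (h : PropImplements Γ BoolRel.equality.costFn ∨
    PropImplements Γ BoolRel.implication.costFn) :
    ∃ (c m : ℕ) (F : Formula Γ (Fin 2 ⊕ Fin m)) (sol : Bool → Bool → Fin m → Bool), 0 < c ∧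
      (∀ s t, F.cost (Sum.elim ![s, t] (sol s t)) = if s = t then 0 else c) ∧
      ∀ s t y, s ≠ t → c ≤ F.cost (Sum.elim ![s, t] y) := by
  rcases h with h | h
  · obtain ⟨c, m, F, sol, hc, hsol, hle⟩ := PropImplements.exists_sol
      (g := fun s t => if s = t then 0 else 1) h (by decide)
    refine ⟨c, m, F, sol, hc, fun s t => (hsol s t).trans (by simp), fun s t y hst => ?_⟩
    simpa [hst] using hle s t y
  · obtain ⟨c, m, F, sol, hc, hsol, hle⟩ := PropImplements.exists_sol
      (g := fun s t => if s = true ∧ t = false then 1 else 0) h (by decide)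
    let F₁ : Formula Γ (Fin 2 ⊕ Fin (m + m)) := F.rename (Sum.map id (Fin.castAdd m))
    let F₂ : Formula Γ (Fin 2 ⊕ Fin (m + m)) := F.rename (Sum.map ![1, 0] (Fin.natAdd m))
    have key : ∀ s t y, Formula.cost (F₁ ++ F₂ : List _) (Sum.elim ![s, t] y) =
        F.cost (Sum.elim ![s, t] (y ∘ Fin.castAdd m)) +
        F.cost (Sum.elim ![t, s] (y ∘ Fin.natAdd m)) := by
      intro s t y
      simp only [F₁, F₂]
      rw [Formula.cost_append, Formula.cost_rename, Formula.cost_rename, Sum.elim_comp_map,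
        Sum.elim_comp_map]
      congr 3
      ext i; fin_cases i <;> rfl
    refine ⟨c, m + m, (F₁ ++ F₂ : List _), fun s t => Fin.append (sol s t) (sol t s), hc,
      fun s t => ?_, fun s t y hst => ?_⟩
    · have h₁ : Fin.append (sol s t) (sol t s) ∘ Fin.castAdd m = sol s t := by
        ext i; simp
      have h₂ : Fin.append (sol s t) (sol t s) ∘ Fin.natAdd m = sol t s := by
        ext i; exact Fin.append_right _ _ _
      rw [key, h₁, h₂, hsol, hsol]
      cases s <;> cases t <;> simp
    · rw [key]
      have e₁ := hle s t (y ∘ Fin.castAdd m)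
      have e₂ := hle t s (y ∘ Fin.natAdd m)
      cases s <;> cases t <;> simp at * <;> omega

/-- The crisp formula for `k = 0` suffices, because prohibitive weights will be put on its
constraints. -/
theorem exists_nand_gadget (h : SupportsCrisp Γ BoolRel.negClause₂) :
    ∃ (m : ℕ) (F : Formula Γ (Fin 2 ⊕ Fin m)) (sol : Bool → Bool → Fin m → Bool),
      (∀ s t, (s && t) = false → F.cost (Sum.elim ![s, t] (sol s t)) = 0) ∧
      ∀ y, 1 ≤ F.cost (Sum.elim ![true, true] y) := by
  obtain ⟨m, F, hF⟩ := h 0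
  have hmem : ∀ s t : Bool, (![s, t] : Fin 2 → Bool) ∈ BoolRel.negClause₂.tuples ↔
      (s && t) = false := by
    intro s t
    change (![s, t] : Fin 2 → Bool) ∈
      Finset.univ.filter (fun t : Fin 2 → Bool => t 0 = false ∨ t 1 = false) ↔ _
    cases s <;> cases t <;> simp
  have : ∀ s t : Bool, ∃ y : Fin m → Bool,
      (s && t) = false → F.cost (Sum.elim ![s, t] y) = 0 := by
    intro s t
    by_cases hst : (s && t) = false
    · obtain ⟨y, hy⟩ := (hF ![s, t]).1 ((hmem s t).2 hst)
      exact ⟨y, fun _ => hy⟩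
    · exact ⟨fun _ => false, fun h => absurd h hst⟩
  choose sol hsol using this
  exact ⟨m, F, sol, hsol, (hF ![true, true]).2 fun h => by simpa using (hmem true true).1 h⟩

/-- Take a tuple of `R` and identify the arguments where it is 0, and those where it is 1. Under
`(0, 1)` the constraint reads this tuple, under `(0, 0)` the all-0 tuple. -/
theorem exists_one_gadget {R : BoolRel} (hR : R ∈ Γ) (hne : R.tuples.Nonempty)
    (hR0 : ¬ R.Valid false) :
    ∃ F : Formula Γ (Fin 2), F.cost ![false, true] = 0 ∧ 1 ≤ F.cost ![false, false] := by
  obtain ⟨t, ht⟩ := hne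
  refine ⟨[⟨R, hR, fun i => if t i then 1 else 0⟩], ?_, ?_⟩
  · rw [Formula.cost_singleton, if_pos]
    change (fun i => _) ∈ R.tuples
    convert ht using 1
    funext i
    cases h : t i <;> simp [h]
  · rw [Formula.cost_singleton, if_neg]
    intro h
    apply hR0
    change (fun i => _) ∈ R.tuples at h
    change (fun _ => false) ∈ R.tuples
    convert h using 1
    funext i
    cases h : t i <;> simp [h]

/-- The edges `ij` and `kl` exclude the patterns `(a, b)` and `(a', b')`. Argument `i` receives `x₀`
with the polarity for which true means `a`, and argument `j` receives `x₁` with the polarity for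
which false means `b`: the excluded pattern becomes `x₀ > x₁`. The other edge is treated alike, and
the remaining arguments become auxiliary variables. -/
theorem exists_bundle_gadget {R : BoolRel} (hR : R ∈ Γ)
    (hG : SimpleGraph.IsIndContained twoK₂ R.gaifman) :
    ∃ (m : ℕ) (F : Formula Γ ((Fin 4 × Bool) ⊕ Fin m)) (sol : Bool → Bool → Fin m → Bool),
      (∀ α, F.cost α ≤ 1) ∧
      (∀ s t, F.cost (Sum.elim (fun v => ![s, s, t, t] v.1 == v.2) (sol s t)) = 0) ∧
      ∀ (x : Fin 4 → Bool) y, (x 0 = true ∧ x 1 = false) ∨ (x 2 = true ∧ x 3 = false) →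
        1 ≤ F.cost (Sum.elim (fun v => x v.1 == v.2) y) := by
  obtain ⟨e⟩ := hG
  have adj : ∀ u v, R.gaifman.Adj (e u) (e v) ↔ twoK₂.Adj u v := fun u v => e.map_rel_iff
  set i := e (.inl 0) with hi
  set j := e (.inl 1) with hj
  set k := e (.inr 0) with hk
  set l := e (.inr 1) with hl
  have hij : i ≠ j := fun h => by simpa using e.injective h
  have hik : i ≠ k := fun h => by simpa using e.injective h
  have hil : i ≠ l := fun h => by simpa using e.injective h
  have hjk : j ≠ k := fun h => by simpa using e.injective h
  have hjl : j ≠ l := fun h => by simpa using e.injective h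
  have hkl : k ≠ l := fun h => by simpa using e.injective h
  obtain ⟨-, a, b, hab⟩ : R.gaifman.Adj i j := (adj _ _).2 (by simp [twoK₂])
  obtain ⟨-, a', b', hab'⟩ : R.gaifman.Adj k l := (adj _ _).2 (by simp [twoK₂])
  -- No edge joins the two edges, so every combination of values occurs at one end of each.
  have full : ∀ u v : Fin 2, ∀ c d : Bool, ∃ t ∈ R.tuples, t (e (.inl u)) = c ∧ t (e (.inr v)) = d := by
    intro u v c d
    by_contra hcon
    push Not at hcon
    have : R.gaifman.Adj (e (.inl u)) (e (.inr v)) :=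
      ⟨fun h => by simpa using e.injective h, c, d, fun t ht h => hcon t ht h.1 h.2⟩
    rw [adj] at this
    simp [twoK₂] at this
  -- Only one end of each edge is prescribed: `a` at `i` if `s` is true, `b` at `j` otherwise. The
  -- excluded pattern then determines the other end. The same is done with `t` on the second edge.
  have tup : ∀ s t : Bool, ∃ τ ∈ R.tuples, τ i = (s == a) ∧ τ j = (s == !b) ∧
      τ k = (t == a') ∧ τ l = (t == !b') := by
    intro s t
    cases s <;> cases t
    · obtain ⟨τ, hτ, h₁, h₂⟩ := full 1 1 b b'
      have e₁ : τ i ≠ a := fun h => hab τ hτ ⟨h, h₁⟩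
      have e₂ : τ k ≠ a' := fun h => hab' τ hτ ⟨h, h₂⟩
      refine ⟨τ, hτ, ?_, ?_, ?_, ?_⟩
      · cases a <;> simpa using e₁
      · rw [hj, h₁]; simp
      · cases a' <;> simpa using e₂
      · rw [hl, h₂]; simp
    · obtain ⟨τ, hτ, h₁, h₂⟩ := full 1 0 b a'
      have e₁ : τ i ≠ a := fun h => hab τ hτ ⟨h, h₁⟩
      have e₂ : τ l ≠ b' := fun h => hab' τ hτ ⟨h₂, h⟩
      refine ⟨τ, hτ, ?_, ?_, ?_, ?_⟩
      · cases a <;> simpa using e₁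
      · rw [hj, h₁]; simp
      · rw [hk, h₂]; simp
      · cases b' <;> simpa using e₂
    · obtain ⟨τ, hτ, h₁, h₂⟩ := full 0 1 a b'
      have e₁ : τ j ≠ b := fun h => hab τ hτ ⟨h₁, h⟩
      have e₂ : τ k ≠ a' := fun h => hab' τ hτ ⟨h, h₂⟩
      refine ⟨τ, hτ, ?_, ?_, ?_, ?_⟩
      · rw [hi, h₁]; simp
      · cases b <;> simpa using e₁
      · cases a' <;> simpa using e₂
      · rw [hl, h₂]; simp
    · obtain ⟨τ, hτ, h₁, h₂⟩ := full 0 0 a a'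
      have e₁ : τ j ≠ b := fun h => hab τ hτ ⟨h₁, h⟩
      have e₂ : τ l ≠ b' := fun h => hab' τ hτ ⟨h₂, h⟩
      refine ⟨τ, hτ, ?_, ?_, ?_, ?_⟩
      · rw [hi, h₁]; simp
      · cases b <;> simpa using e₁
      · rw [hk, h₂]; simp
      · cases b' <;> simpa using e₂
  choose sol hsol hsi hsj hsk hsl using tup
  let scope : Fin R.arity → (Fin 4 × Bool) ⊕ Fin R.arity := fun u =>
    if u = i then .inl (0, a) else if u = j then .inl (1, !b) else
    if u = k then .inl (2, a') else if u = l then .inl (3, !b') else .inr u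
  refine ⟨R.arity, [⟨R, hR, scope⟩], sol, fun α => ?_, fun s t => ?_, fun x y h => ?_⟩
  · rw [Formula.cost_singleton]; split <;> omega
  · rw [Formula.cost_singleton, if_pos]
    change (fun u => _) ∈ R.tuples
    convert hsol s t using 1
    funext u
    simp only [scope]
    split_ifs with h₁ h₂ h₃ h₄
    · subst h₁; simpa using (hsi s t).symm
    · subst h₂; simpa using (hsj s t).symm
    · subst h₃; simpa using (hsk s t).symm
    · subst h₄; simpa using (hsl s t).symm
    · rfl
  · rw [Formula.cost_singleton, if_neg]
    intro hsat
    change (fun u => _) ∈ R.tuples at hsat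
    rcases h with ⟨h₀, h₁⟩ | ⟨h₀, h₁⟩
    · refine hab _ hsat ⟨?_, ?_⟩
      · simp [scope, h₀]
      · simp [scope, h₁, hij.symm]
    · refine hab' _ hsat ⟨?_, ?_⟩
      · simp [scope, h₀, hik.symm, hjk.symm]
      · simp [scope, h₁, hil.symm, hjl.symm, hkl.symm]

theorem nonempty_gadgets (hGaifman : ∃ R ∈ Γ, SimpleGraph.IsIndContained twoK₂ R.gaifman)
    (hCrisp : SupportsCrisp Γ BoolRel.negClause₂)
    (hImpl : PropImplements Γ BoolRel.equality.costFn ∨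
      PropImplements Γ BoolRel.implication.costFn)
    (hnt : ¬ TrivialMinSAT Γ) : Nonempty (Gadgets Γ) := by
  obtain ⟨R, hR, hG⟩ := hGaifman
  -- The constant 0 will come from the clause `¬z ∨ ¬z`; non-triviality yields a relation that
  -- forces a 1 next to it.
  obtain ⟨R₀, hR₀, hne, hval⟩ : ∃ R ∈ Γ, R.tuples.Nonempty ∧ ¬ R.Valid false := by
    by_contra hcon
    push Not at hcon
    exact hnt ⟨false, hcon⟩
  obtain ⟨c, m₁, F₁, s₁, hc, h₁, h₁'⟩ := exists_eq_gadget hImpl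
  obtain ⟨m₂, F₂, s₂, h₂, h₂'⟩ := exists_nand_gadget hCrisp
  obtain ⟨F₃, h₃, h₃'⟩ := exists_one_gadget hR₀ hne hval
  obtain ⟨m₄, F₄, s₄, h₄, h₄', h₄''⟩ := exists_bundle_gadget hR hG
  exact ⟨⟨c, hc, m₁, F₁, s₁, h₁, h₁', m₂, F₂, s₂, h₂, h₂', F₃, h₃, h₃', m₄, F₄, s₄, h₄, h₄', h₄''⟩⟩

end Exists

/-! ## Names of variables -/

/-- An injective coding of pairs of numbers. -/
def pairCode (a b : ℕ) : ℕ := (a + b) * (a + b) + a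

/-- Squares of consecutive sums differ by `2 * (a + b) + 1`, which exceeds `a`; so the code
determines the sum, and then `a`. -/
theorem pairCode_inj {a b c d : ℕ} : pairCode a b = pairCode c d ↔ a = c ∧ b = d := by
  refine ⟨fun h => ?_, by rintro ⟨rfl, rfl⟩; rfl⟩
  unfold pairCode at h
  have h₁ : a + b = c + d := by
    rcases lt_trichotomy (a + b) (c + d) with hlt | heq | hlt
    · nlinarith
    · exact heq
    · nlinarith
  rw [h₁] at h
  omega

/-- The variable number `(a, b, c, d)` of sort `t`. -/
def varName (t a b c d : ℕ) : ℕ := pairCode t (pairCode a (pairCode b (pairCode c d)))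

theorem varName_inj {t a b c d t' a' b' c' d' : ℕ} :
    varName t a b c d = varName t' a' b' c' d' ↔
      t = t' ∧ a = a' ∧ b = b' ∧ c = c' ∧ d = d' := by
  simp only [varName, pairCode_inj]

/-! ## Costs of weighted formulas -/

section Cost

variable {Γ : ConstraintLang}

/-- The sum of `θ (ω(C))` over the violated constraints `C`, where `ω` is the weight. -/
def totalCost (θ : ℕ → ℕ) (α : ℕ → Bool) (F : List (WConstraint Γ)) : ℕ :=
  (F.map fun C => if C.toConstraint.Sat α then 0 else θ C.weight).sum

/-- For a given assignment the least deletion set consists of the constraints that it violates.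
Number and weight are the cases `θ = 1` and `θ = id` of one cost. -/
theorem weightedMinSAT_yes_iff (I : WMinSATInst Γ) : (weightedMinSAT Γ).Yes I ↔
    ∃ α, totalCost (fun _ => 1) α I.formula ≤ I.k ∧ totalCost (fun w => w) α I.formula ≤ I.W := by
  have key : ∀ (θ : ℕ → ℕ) (α : ℕ → Bool), totalCost θ α I.formula =
      ∑ i ∈ Finset.univ.filter (fun i => ¬ (I.formula.get i).toConstraint.Sat α),
        θ (I.formula.get i).weight := by
    intro θ α
    rw [totalCost, Finset.sum_filter, ← List.sum_ofFn]
    congr 1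
    apply List.ext_get
    · simp
    · intro n h₁ h₂
      simp [ite_not]
  constructor
  · rintro ⟨Z, ⟨α, hα⟩, hk, hW⟩
    have hsub : Finset.univ.filter (fun i => ¬ (I.formula.get i).toConstraint.Sat α) ⊆ Z := by
      intro i hi
      by_contra hZ
      exact (Finset.mem_filter.1 hi).2 (hα i hZ)
    refine ⟨α, ?_, ?_⟩
    · rw [key]
      exact (Finset.sum_le_sum_of_subset hsub).trans (by simpa using hk)
    · rw [key]
      exact (Finset.sum_le_sum_of_subset hsub).trans hW
  · rintro ⟨α, hk, hW⟩
    refine ⟨Finset.univ.filter (fun i => ¬ (I.formula.get i).toConstraint.Sat α),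
      ⟨α, fun i hi => ?_⟩, ?_, ?_⟩
    · simpa using hi
    · rw [key] at hk
      simpa using hk
    · rw [key] at hW
      exact hW

variable (θ : ℕ → ℕ) (α : ℕ → Bool)

theorem totalCost_append (F F' : List (WConstraint Γ)) :
    totalCost θ α (F ++ F') = totalCost θ α F + totalCost θ α F' := by
  simp [totalCost]

theorem totalCost_flatMap_range (n : ℕ) (F : ℕ → List (WConstraint Γ)) :
    totalCost θ α ((List.range n).flatMap F) = ∑ i ∈ Finset.range n, totalCost θ α (F i) := by
  induction n with
  | zero => rfl
  | succ n ih => rw [List.range_succ, List.flatMap_append, totalCost_append, ih,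
      Finset.sum_range_succ]; simp

/-- The formula `F` with the variables renamed by `ρ`, and with all weights equal to `w`. -/
def placeFormula {V : Type} (F : Formula Γ V) (ρ : V → ℕ) (w : ℕ) : List (WConstraint Γ) :=
  F.map fun C => ⟨⟨C.rel, C.mem, ρ ∘ C.scope⟩, w.toPNat'⟩

theorem totalCost_placeFormula {V : Type} (F : Formula Γ V) (ρ : V → ℕ) {w : ℕ} (hw : 0 < w) :
    totalCost θ α (placeFormula F ρ w) = θ w * F.cost (α ∘ ρ) := by
  induction F with
  | nil => simp [totalCost, placeFormula, Formula.cost]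
  | cons C F ih =>
    have h₁ : totalCost θ α (placeFormula (C :: F) ρ w) =
        (if C.Sat (α ∘ ρ) then 0 else θ w) + totalCost θ α (placeFormula F ρ w) := by
      simp only [totalCost, placeFormula, List.map_cons, List.sum_cons, Nat.toPNat'_coe, hw,
        if_true]
      rfl
    rw [h₁, ih]
    by_cases h : C.Sat (α ∘ ρ)
    · simp [Formula.cost, h]
    · simp [Formula.cost, h]; ring

end Cost

namespace PolyTime

variable {Γ : ConstraintLang} {α : Type} [DataEnc α]

-- The gadget is fixed, so its truth tables are constants and induction over its constraints is
-- allowed; only names and weights depend on the input.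
@[fun_prop]
theorem placeFormula {V : Type} (F : Formula Γ V) {ρ : α → V → ℕ} {w : α → ℕ}
    (hρ : ∀ v, PolyTime (fun x => ρ x v)) (hw : PolyTime w) :
    PolyTime (fun x => placeFormula F (ρ x) (w x)) := by
  induction F with
  | nil => exact const []
  | cons C F ih =>
    -- With truncated subtraction, `w + (1 - w)` is the maximum of `w` and 1, which is the value of
    -- `toPNat'`.
    have h₁ : PolyTime fun x => (C.rel.truthTable, List.ofFn (ρ x ∘ C.scope), w x + (1 - w x)) :=
      (const _).prodMk ((ofFn fun i => hρ (C.scope i)).prodMk (by fun_prop))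
    have h₂ : PolyTime fun x =>
        (⟨⟨C.rel, C.mem, ρ x ∘ C.scope⟩, (w x).toPNat'⟩ : WConstraint Γ) := by
      obtain ⟨p, T, h⟩ := h₁
      have : ∀ x, enc (⟨⟨C.rel, C.mem, ρ x ∘ C.scope⟩, (w x).toPNat'⟩ : WConstraint Γ) =
          enc (C.rel.truthTable, List.ofFn (ρ x ∘ C.scope), w x + (1 - w x)) := by
        intro x
        have : ((w x).toPNat' : ℕ) = w x + (1 - w x) := by
          rw [Nat.toPNat'_coe]; split <;> omega
        rw [← this]
        rfl
      exact ⟨p, T, fun x => by rw [this]; exact h x⟩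
    exact h₂.cons ih

@[fun_prop]
theorem range_mul {m n : α → ℕ} (hm : PolyTime fun x => List.range (m x))
    (hn : PolyTime fun x => List.range (n x)) : PolyTime fun x => List.range (m x * n x) := by
  have : PolyTime fun x =>
      List.range ((List.range (m x)).flatMap fun _ => List.range (n x)).length :=
    (hm.flatMap (hn.comp prod_fst)).range_length
  simpa using this

@[fun_prop]
theorem range_succ {n : α → ℕ} (hn : PolyTime fun x => List.range (n x)) :
    PolyTime fun x => List.range (n x + 1) := by
  have : PolyTime fun x => List.range (0 :: List.range (n x)).length := by fun_prop
  simpa using this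

theorem of_range {n : α → ℕ} (hn : PolyTime fun x => List.range (n x)) : PolyTime n := by
  simpa using hn.length

@[fun_prop]
theorem varName {t a b c d : α → ℕ} (ht : PolyTime t) (ha : PolyTime a) (hb : PolyTime b)
    (hc : PolyTime c) (hd : PolyTime d) :
    PolyTime fun x => varName (t x) (a x) (b x) (c x) (d x) := by
  simp only [_root_.varName, pairCode]
  fun_prop

end PolyTime

/-! ## The hard instances -/

/-- The variable that is false. -/
def zeroVar : ℕ := varName 0 0 0 0 0

/-- The variable that is true. -/
def oneVar : ℕ := varName 1 0 0 0 0

/-- The `j`-th variable of the falling chain of the pair `(p, q)`. -/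
def posVar (p q j : ℕ) : ℕ := varName 2 p q j 0

/-- The `j`-th variable of the rising chain of the pair `(p, q)`. -/
def negVar (p q j : ℕ) : ℕ := varName 3 p q j 0

/-- The variable that tells whether the value of `p` is at least `u`. -/
def selVar (p u : ℕ) : ℕ := varName 4 p u 0 0

namespace Gadgets

variable {Γ : ConstraintLang} (G : Gadgets Γ)

/-- The equality `x = y` with weight `w`. -/
def eqC (x y w : ℕ) : List (WConstraint Γ) :=
  -- Auxiliary variables are named after `x` and `y` alone, so placements on the same pair share
  -- them. This is harmless, as the optimal auxiliary values depend only on the values of `x` and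
  -- `y`.
  placeFormula G.eqF (Sum.elim ![x, y] fun a => varName 5 x y a 0) w

/-- The clause `¬ x ∨ ¬ y` with weight `w`. -/
def nandC (x y w : ℕ) : List (WConstraint Γ) :=
  placeFormula G.nandF (Sum.elim ![x, y] fun a => varName 6 x y a 0) w

/-- The bundle of the constraints `x₀ = x₁` and `x₂ = x₃`, with `yᵢ` the complement of `xᵢ`. -/
def bundleC (x₀ x₁ x₂ x₃ y₀ y₁ y₂ y₃ : ℕ) : List (WConstraint Γ) :=
  placeFormula G.bunF (Sum.elim
    (fun v => bif v.2 then ![x₀, x₁, x₂, x₃] v.1 else ![y₀, y₁, y₂, y₃] v.1)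
    fun a => varName 7 x₀ x₂ a 0) 1

/-- The bound on the weight. -/
def boundW (K N : ℕ) : ℕ := K * K * ((K * K + 1) * (G.c * (N * N + 1))) + K * K

/-- The bound on the number of deleted constraints. -/
def boundK (K : ℕ) : ℕ := K * K * (2 * G.c) + K * K

/-- The constraints of prohibitive weight `w`: they fix the two constants and the ends of the
chains, exclude that corresponding variables of the two chains of a pair are both true, and make
all chains of pairs `(p, q)` agree on the value of `p`. -/
def crispPart (K N w : ℕ) : List (WConstraint Γ) :=
  G.nandC zeroVar zeroVar w ++ placeFormula G.oneF ![zeroVar, oneVar] w ++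
  (List.range K).flatMap fun p => (List.range K).flatMap fun q =>
    G.eqC (posVar p q 0) oneVar w ++ G.eqC (posVar p q (N * N)) zeroVar w ++
    G.eqC (negVar p q 0) zeroVar w ++ G.eqC (negVar p q (N * N)) oneVar w ++
    ((List.range (N * N + 1)).flatMap fun j => G.nandC (posVar p q j) (negVar p q j) w) ++
    -- If the chain is cut at `i * N + j` with `j < N`, its variable number `u * N` is true iff `u ≤
    -- i`.
    (List.range N).flatMap fun u => G.eqC (selVar p u) (posVar p q (u * N)) w

/-- The chains: one link of each has to be cut. -/
def chainPart (K N : ℕ) : List (WConstraint Γ) :=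
  (List.range K).flatMap fun p => (List.range K).flatMap fun q =>
    (List.range (N * N)).flatMap fun j =>
      -- At each position the two weights add up to `(K² + 1)(N² + 1)`, and a cut violates `c`
      -- constraints. Over the `K²` pairs, with `K²` more for bundles, this gives `boundW` and
      -- `boundK`.
      G.eqC (posVar p q j) (posVar p q (j + 1)) ((K * K + 1) * (N * N - j)) ++
      G.eqC (negVar p q j) (negVar p q (j + 1)) ((K * K + 1) * (j + 1))

/-- The bundles, which relate the chain of `(p, q)` to the chain of `(q, p)`. -/
def bundlePart (K N : ℕ) (A : ℕ → ℕ → ℕ → ℕ → Bool) (w : ℕ) : List (WConstraint Γ) :=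
  (List.range K).flatMap fun p => (List.range K).flatMap fun q =>
    (List.range N).flatMap fun i => (List.range N).flatMap fun j =>
      -- Both links stand for `p = i`, `q = j`. If these values are forbidden, prohibitive
      -- equalities keep the links from being cut.
      bif A p q i j then
        G.bundleC (posVar p q (i * N + j)) (posVar p q (i * N + j + 1))
          (posVar q p (j * N + i)) (posVar q p (j * N + i + 1))
          (negVar p q (i * N + j)) (negVar p q (i * N + j + 1))
          (negVar q p (j * N + i)) (negVar q p (j * N + i + 1))
      else
        G.eqC (posVar p q (i * N + j)) (posVar p q (i * N + j + 1)) w ++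
        G.eqC (posVar q p (j * N + i)) (posVar q p (j * N + i + 1)) w

/-- The instance of Weighted Min SAT that expresses a binary constraint satisfaction problem with
`K` variables, with values below `N`, where `A p q i j` tells whether the variables `p` and `q`
may have the values `i` and `j`. -/
def hardInst (K N : ℕ) (A : ℕ → ℕ → ℕ → ℕ → Bool) : WMinSATInst Γ where
  formula := G.crispPart K N (G.boundW K N + 1) ++ G.chainPart K N ++
    G.bundlePart K N A (G.boundW K N + 1)
  k := G.boundK K
  W := G.boundW K N

end Gadgets

namespace PolyTime

variable {Γ : ConstraintLang} (G : Gadgets Γ) {α : Type} [DataEnc α]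

@[fun_prop]
theorem eqC {x y w : α → ℕ} (hx : PolyTime x) (hy : PolyTime y) (hw : PolyTime w) :
    PolyTime fun i => G.eqC (x i) (y i) (w i) := by
  refine placeFormula _ ?_ hw
  rintro (v | a)
  · fin_cases v
    exacts [hx, hy]
  · change PolyTime fun i => _root_.varName 5 (x i) (y i) a 0
    fun_prop

@[fun_prop]
theorem nandC {x y w : α → ℕ} (hx : PolyTime x) (hy : PolyTime y) (hw : PolyTime w) :
    PolyTime fun i => G.nandC (x i) (y i) (w i) := by
  refine placeFormula _ ?_ hw
  rintro (v | a)
  · fin_cases v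
    exacts [hx, hy]
  · change PolyTime fun i => _root_.varName 6 (x i) (y i) a 0
    fun_prop

@[fun_prop]
theorem bundleC {x₀ x₁ x₂ x₃ y₀ y₁ y₂ y₃ : α → ℕ} (hx₀ : PolyTime x₀) (hx₁ : PolyTime x₁)
    (hx₂ : PolyTime x₂) (hx₃ : PolyTime x₃) (hy₀ : PolyTime y₀) (hy₁ : PolyTime y₁)
    (hy₂ : PolyTime y₂) (hy₃ : PolyTime y₃) :
    PolyTime fun i => G.bundleC (x₀ i) (x₁ i) (x₂ i) (x₃ i) (y₀ i) (y₁ i) (y₂ i) (y₃ i) := by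
  refine placeFormula _ ?_ (const 1)
  rintro (⟨v, b⟩ | a)
  · fin_cases v <;> cases b
    exacts [hy₀, hx₀, hy₁, hx₁, hy₂, hx₂, hy₃, hx₃]
  · change PolyTime fun i => _root_.varName 7 (x₀ i) (x₂ i) a 0
    fun_prop

@[fun_prop]
theorem boundW {K N : α → ℕ} (hK : PolyTime K) (hN : PolyTime N) :
    PolyTime fun x => G.boundW (K x) (N x) := by
  unfold Gadgets.boundW; fun_prop

theorem hardInst {K N : α → ℕ} {A : α → ℕ → ℕ → ℕ → ℕ → Bool}
    (hK : PolyTime fun x => List.range (K x)) (hN : PolyTime fun x => List.range (N x))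
    (hA : PolyTime fun y : (((α × ℕ) × ℕ) × ℕ) × ℕ =>
      A y.1.1.1.1 y.1.1.1.2 y.1.1.2 y.1.2 y.2) :
    PolyTime fun x => G.hardInst (K x) (N x) (A x) := by
  have hK' : PolyTime K := of_range hK
  have hN' : PolyTime N := of_range hN
  have hM := range_mul hN hN
  have hM' := range_succ hM
  -- The ranges are made opaque, so that they enter through the hypotheses on them and not through
  -- their bounds.
  obtain ⟨rK, erK⟩ : ∃ r : α → List ℕ, ∀ x, List.range (K x) = r x := ⟨_, fun _ => rfl⟩
  obtain ⟨rN, erN⟩ : ∃ r : α → List ℕ, ∀ x, List.range (N x) = r x := ⟨_, fun _ => rfl⟩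
  obtain ⟨rM, erM⟩ : ∃ r : α → List ℕ, ∀ x, List.range (N x * N x) = r x := ⟨_, fun _ => rfl⟩
  obtain ⟨rM', erM'⟩ : ∃ r : α → List ℕ, ∀ x, List.range (N x * N x + 1) = r x :=
    ⟨_, fun _ => rfl⟩
  replace hK : PolyTime rK := by simpa only [erK] using hK
  replace hN : PolyTime rN := by simpa only [erN] using hN
  replace hM : PolyTime rM := by simpa only [erM] using hM
  replace hM' : PolyTime rM' := by simpa only [erM'] using hM'
  have hW : PolyTime fun x => G.boundW (K x) (N x) := by fun_prop
  have hk : PolyTime fun x => G.boundK (K x) := by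
    unfold Gadgets.boundK; fun_prop
  have h₁ : PolyTime fun x => G.crispPart (K x) (N x) (G.boundW (K x) (N x) + 1) := by
    unfold Gadgets.crispPart posVar negVar selVar
    have h : PolyTime fun x => _root_.placeFormula G.oneF ![zeroVar, oneVar]
        (G.boundW (K x) (N x) + 1) :=
      placeFormula _ (fun v => const _) (by fun_prop)
    obtain ⟨Q, hQ⟩ : ∃ Q : α → List (WConstraint Γ), ∀ x, _root_.placeFormula G.oneF
        ![zeroVar, oneVar] (G.boundW (K x) (N x) + 1) = Q x := ⟨_, fun _ => rfl⟩
    replace h : PolyTime Q := by simpa only [hQ] using h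
    simp only [erK, erN, erM', hQ]
    fun_prop
  have h₂ : PolyTime fun x => G.chainPart (K x) (N x) := by
    unfold Gadgets.chainPart posVar negVar
    simp only [erK, erM]
    fun_prop
  have h₃ : PolyTime fun x => G.bundlePart (K x) (N x) (A x) (G.boundW (K x) (N x) + 1) := by
    unfold Gadgets.bundlePart posVar negVar
    simp only [erK, erN]
    refine hK.flatMap ((hK.comp prod_fst).flatMap ((hN.comp (prod_fst.comp prod_fst)).flatMap
      ((hN.comp (prod_fst.comp (prod_fst.comp prod_fst))).flatMap (hA.cond ?_ ?_))))
    · fun_prop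
    · fun_prop
  exact ((h₁.append h₂).append h₃).prodMk (hk.prodMk hW)

end PolyTime

/-! ## Correctness of the hard instances -/

/-- The names of variables that are not auxiliary. -/
def IsMainVar (x : ℕ) : Prop := ∃ t a b c, t < 5 ∧ x = varName t a b c 0

theorem isMainVar_zeroVar : IsMainVar zeroVar := ⟨0, _, _, _, by omega, rfl⟩
theorem isMainVar_oneVar : IsMainVar oneVar := ⟨1, _, _, _, by omega, rfl⟩
theorem isMainVar_posVar (p q j : ℕ) : IsMainVar (posVar p q j) := ⟨2, _, _, _, by omega, rfl⟩
theorem isMainVar_negVar (p q j : ℕ) : IsMainVar (negVar p q j) := ⟨3, _, _, _, by omega, rfl⟩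
theorem isMainVar_selVar (p u : ℕ) : IsMainVar (selVar p u) := ⟨4, _, _, _, by omega, rfl⟩

namespace Gadgets

variable {Γ : ConstraintLang} (G : Gadgets Γ)

/-- The auxiliary variables have their optimal values. -/
structure Canonical (α : ℕ → Bool) : Prop where
  eq : ∀ x y, IsMainVar x → IsMainVar y →
    ∀ a : Fin G.eqAux, α (varName 5 x y a 0) = G.eqSol (α x) (α y) a
  nand : ∀ x y, IsMainVar x → IsMainVar y →
    ∀ a : Fin G.nandAux, α (varName 6 x y a 0) = G.nandSol (α x) (α y) a
  bun : ∀ x y, IsMainVar x → IsMainVar y →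
    ∀ a : Fin G.bunAux, α (varName 7 x y a 0) = G.bunSol (α x) (α y) a

/-- The auxiliary variables that matter are named after main variables, never after auxiliary ones.
The main values can therefore be prescribed freely, and the auxiliary values computed from them. -/
theorem exists_canonical (β : ℕ → ℕ → ℕ → ℕ → Bool) :
    ∃ α, G.Canonical α ∧ ∀ t a b c, t < 5 → α (varName t a b c 0) = β t a b c := by
  let name : ℕ × ℕ × ℕ × ℕ × ℕ → ℕ := fun v => varName v.1 v.2.1 v.2.2.1 v.2.2.2.1 v.2.2.2.2
  have hname : Function.Injective name := by
    rintro ⟨t, a, b, c, d⟩ ⟨t', a', b', c', d'⟩ h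
    obtain ⟨h₁, h₂, h₃, h₄, h₅⟩ := varName_inj.1 h
    simp only at h₁ h₂ h₃ h₄ h₅
    subst h₁ h₂ h₃ h₄ h₅
    rfl
  let dec : ℕ → ℕ × ℕ × ℕ × ℕ × ℕ := Function.invFun name
  have hdec : ∀ t a b c d, dec (varName t a b c d) = (t, a, b, c, d) := fun t a b c d =>
    Function.leftInverse_invFun hname (t, a, b, c, d)
  let base : ℕ → Bool := fun n => β (dec n).1 (dec n).2.1 (dec n).2.2.1 (dec n).2.2.2.1
  let ext : {m : ℕ} → (Bool → Bool → Fin m → Bool) → ℕ → Bool := fun {m} sol n =>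
    if h : (dec n).2.2.2.1 < m then sol (base (dec n).2.1) (base (dec n).2.2.1) ⟨_, h⟩ else false
  let α : ℕ → Bool := fun n =>
    if (dec n).1 = 5 then ext G.eqSol n else if (dec n).1 = 6 then ext G.nandSol n else
    if (dec n).1 = 7 then ext G.bunSol n else base n
  have hmain : ∀ t a b c, t < 5 → α (varName t a b c 0) = β t a b c := by
    intro t a b c ht
    simp only [α, base, hdec, ht.ne, show t ≠ 6 by omega, show t ≠ 7 by omega, if_false]
  have hbase : ∀ x, IsMainVar x → base x = α x := by
    rintro x ⟨t, a, b, c, ht, rfl⟩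
    rw [hmain t a b c ht]
    simp only [base, hdec]
  have hext : ∀ {m : ℕ} (sol : Bool → Bool → Fin m → Bool) (t x y : ℕ) (a : Fin m),
      IsMainVar x → IsMainVar y → ext sol (varName t x y a 0) = sol (α x) (α y) a := by
    intro m sol t x y a hx hy
    simp only [ext, hdec, hbase x hx, hbase y hy, a.2, dif_pos]
  refine ⟨α, ⟨fun x y hx hy a => ?_, fun x y hx hy a => ?_, fun x y hx hy a => ?_⟩, hmain⟩
  · rw [← hext G.eqSol 5 x y a hx hy]; simp [α, hdec]
  · rw [← hext G.nandSol 6 x y a hx hy]; simp [α, hdec]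
  · rw [← hext G.bunSol 7 x y a hx hy]; simp [α, hdec]

section Cost

variable {G} (θ : ℕ → ℕ) {α : ℕ → Bool} {x y w : ℕ}

theorem comp_elim (α : ℕ → Bool) (x y : ℕ) {m : ℕ} (f : Fin m → ℕ) :
    α ∘ Sum.elim ![x, y] f = Sum.elim ![α x, α y] (α ∘ f) := by
  rw [Sum.comp_elim]
  congr 1
  ext i; fin_cases i <;> rfl

/-- Lower bounds hold for every assignment, since the gadgets guarantee them for all auxiliary
values; the exact costs below require a canonical assignment. -/
theorem le_totalCost_eqC (hw : 0 < w) (h : α x ≠ α y) :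
    θ w * G.c ≤ totalCost θ α (G.eqC x y w) := by
  rw [eqC, totalCost_placeFormula _ _ _ _ hw, comp_elim]
  exact Nat.mul_le_mul_left _ (G.le_eq _ _ _ h)

theorem le_totalCost_nandC (hw : 0 < w) (hx : α x = true) (hy : α y = true) :
    θ w ≤ totalCost θ α (G.nandC x y w) := by
  rw [nandC, totalCost_placeFormula _ _ _ _ hw, comp_elim, hx, hy]
  exact Nat.le_mul_of_pos_right _ (G.le_nand _)

theorem Canonical.totalCost_eqC (hα : G.Canonical α) (hw : 0 < w) (hx : IsMainVar x)
    (hy : IsMainVar y) :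
    totalCost θ α (G.eqC x y w) = if α x = α y then 0 else θ w * G.c := by
  have : α ∘ (fun a : Fin G.eqAux => varName 5 x y a 0) = G.eqSol (α x) (α y) :=
    funext (hα.eq x y hx hy)
  rw [eqC, totalCost_placeFormula _ _ _ _ hw, comp_elim, this, G.eq_sol]
  split <;> simp

theorem Canonical.totalCost_nandC (hα : G.Canonical α) (hw : 0 < w) (hx : IsMainVar x)
    (hy : IsMainVar y) (h : (α x && α y) = false) : totalCost θ α (G.nandC x y w) = 0 := by
  have : α ∘ (fun a : Fin G.nandAux => varName 6 x y a 0) = G.nandSol (α x) (α y) :=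
    funext (hα.nand x y hx hy)
  rw [nandC, totalCost_placeFormula _ _ _ _ hw, comp_elim, this, G.nand_sol _ _ h, mul_zero]

variable {x₀ x₁ x₂ x₃ y₀ y₁ y₂ y₃ : ℕ}

theorem comp_elim_bundle (h₀ : α y₀ = !α x₀) (h₁ : α y₁ = !α x₁) (h₂ : α y₂ = !α x₂)
    (h₃ : α y₃ = !α x₃) {m : ℕ} (f : Fin m → ℕ) :
    α ∘ Sum.elim (fun v : Fin 4 × Bool =>
      bif v.2 then ![x₀, x₁, x₂, x₃] v.1 else ![y₀, y₁, y₂, y₃] v.1) f =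
    Sum.elim (fun v => ![α x₀, α x₁, α x₂, α x₃] v.1 == v.2) (α ∘ f) := by
  rw [Sum.comp_elim]
  congr 1
  ext ⟨v, b⟩
  fin_cases v <;> cases b <;> simp [h₀, h₁, h₂, h₃]

theorem totalCost_bundleC_le :
    totalCost θ α (G.bundleC x₀ x₁ x₂ x₃ y₀ y₁ y₂ y₃) ≤ θ 1 := by
  rw [bundleC, totalCost_placeFormula _ _ _ _ one_pos]
  exact (Nat.mul_le_mul_left _ (G.bun_le_one _)).trans (by simp)

theorem le_totalCost_bundleC (h₀ : α y₀ = !α x₀) (h₁ : α y₁ = !α x₁) (h₂ : α y₂ = !α x₂)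
    (h₃ : α y₃ = !α x₃) (h : (α x₀ = true ∧ α x₁ = false) ∨ (α x₂ = true ∧ α x₃ = false)) :
    θ 1 ≤ totalCost θ α (G.bundleC x₀ x₁ x₂ x₃ y₀ y₁ y₂ y₃) := by
  rw [bundleC, totalCost_placeFormula _ _ _ _ one_pos, comp_elim_bundle h₀ h₁ h₂ h₃]
  exact Nat.le_mul_of_pos_right _ (G.le_bun _ _ h)

theorem Canonical.totalCost_bundleC (hα : G.Canonical α) (hx₀ : IsMainVar x₀)
    (hx₂ : IsMainVar x₂) (h₀ : α y₀ = !α x₀) (h₁ : α y₁ = !α x₁) (h₂ : α y₂ = !α x₂)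
    (h₃ : α y₃ = !α x₃) (h₀₁ : α x₁ = α x₀) (h₂₃ : α x₃ = α x₂) :
    totalCost θ α (G.bundleC x₀ x₁ x₂ x₃ y₀ y₁ y₂ y₃) = 0 := by
  have : α ∘ (fun a : Fin G.bunAux => varName 7 x₀ x₂ a 0) = G.bunSol (α x₀) (α x₂) :=
    funext (hα.bun x₀ x₂ hx₀ hx₂)
  rw [bundleC, totalCost_placeFormula _ _ _ _ one_pos, comp_elim_bundle h₀ h₁ h₂ h₃, this,
    h₀₁, h₂₃, G.bun_sol, mul_zero]

end Cost

end Gadgets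

/-! ### Positions on the chains, and the cost of a pair of chains. -/

theorem mul_add_inj {N i j i' j' : ℕ} (hj : j < N) (hj' : j' < N)
    (h : i * N + j = i' * N + j') : i = i' ∧ j = j' := by
  have h₁ : i = i' := by
    rcases lt_trichotomy i i' with hlt | heq | hlt
    · nlinarith
    · exact heq
    · nlinarith
  subst h₁
  exact ⟨rfl, by omega⟩

theorem mul_add_lt_mul {N i j : ℕ} (hi : i < N) (hj : j < N) : i * N + j < N * N := by
  nlinarith

theorem decide_le_succ_eq {a j : ℕ} (h : j ≠ a) : decide (j + 1 ≤ a) = decide (j ≤ a) := by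
  rw [decide_eq_decide]; omega

theorem decide_lt_succ_eq {a j : ℕ} (h : j ≠ a) : decide (a < j + 1) = decide (a < j) := by
  rw [decide_eq_decide]; omega

/-- The cost of two chains of length `M`, one falling and the other one rising. -/
def chainCost (M : ℕ) (f g : ℕ → Bool) : ℕ :=
  ∑ j ∈ Finset.range M,
    ((if f j = f (j + 1) then 0 else M - j) + (if g j = g (j + 1) then 0 else j + 1))

theorem add_le_sum_of_ne {ι : Type} [DecidableEq ι] {s : Finset ι} (F : ι → ℕ) {i j : ι}
    (hi : i ∈ s) (hj : j ∈ s) (hij : i ≠ j) : F i + F j ≤ ∑ x ∈ s, F x := by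
  rw [← Finset.sum_pair hij]
  exact Finset.sum_le_sum_of_subset (by
    intro x hx
    rcases Finset.mem_insert.1 hx with rfl | hx
    · exact hi
    · rwa [Finset.mem_singleton.1 hx])

/-- The lower bounds of the other terms use up all of the budget but `m + e`. The slack `e` will be
`K²` for the chains and 0 for the bundles. -/
theorem le_add_of_sum_le {ι : Type} [DecidableEq ι] {s : Finset ι} {F : ι → ℕ} {m e : ℕ}
    (hm : ∀ i ∈ s, m ≤ F i) (h : ∑ i ∈ s, F i ≤ s.card * m + e) {i : ι} (hi : i ∈ s) :
    F i ≤ m + e := by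
  have h₁ : (s.erase i).card * m ≤ ∑ x ∈ s.erase i, F x :=
    Finset.card_nsmul_le_sum (s.erase i) F m fun j hj => hm j (Finset.mem_of_mem_erase hj)
  rw [← Finset.add_sum_erase _ _ hi] at h
  have h₂ : s.card = (s.erase i).card + 1 := (Finset.card_erase_add_one hi).symm
  rw [h₂, Nat.succ_mul] at h
  omega

/-- Let `a` be the link of the first fall of `f` and `b` that of the last rise of `g`. Since `f` is
true up to `a` and `g` is true beyond `b`, the clauses force `a ≤ b`, so the cost is at least `(M -
a) + (b + 1) ≥ M + 1`. Equality leaves only `a = b` and no further break, because every link has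
positive weight. -/
theorem le_chainCost {M : ℕ} {f g : ℕ → Bool} (hf : f 0 = true) (hfM : f M = false)
    (hgM : g M = true) (hfg : ∀ j ≤ M, (f j && g j) = false) :
    M + 1 ≤ chainCost M f g ∧ (chainCost M f g ≤ M + 1 →
      ∃ a < M, ∀ j ≤ M, f j = decide (j ≤ a) ∧ g j = decide (a < j)) := by
  obtain ⟨a, haM, hfa, hfa'⟩ : ∃ a < M, (∀ j ≤ a, f j = true) ∧ f (a + 1) = false := by
    have hex : ∃ j, f j = false := ⟨M, hfM⟩
    have h₁ := Nat.find_spec hex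
    have h₂ := Nat.find_min' hex hfM
    have h₃ : Nat.find hex ≠ 0 := fun h => by rw [h, hf] at h₁; simp at h₁
    refine ⟨Nat.find hex - 1, by omega, fun j hj => ?_, ?_⟩
    · have := Nat.find_min hex (show j < Nat.find hex by omega)
      simpa using this
    · rwa [show Nat.find hex - 1 + 1 = Nat.find hex by omega]
  obtain ⟨b, hbM, hgb, hgb'⟩ : ∃ b < M, g b = false ∧ ∀ j, b < j → j ≤ M → g j = true := by
    -- `g 0` is false because `f 0` is true; the search runs backwards from `M`.
    have h0 : g (M - M) = false := by
      have := hfg 0 (Nat.zero_le _)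
      simpa [hf] using this
    have hex : ∃ i, g (M - i) = false := ⟨M, h0⟩
    have h₁ := Nat.find_spec hex
    have h₂ := Nat.find_min' hex h0
    have h₃ : Nat.find hex ≠ 0 := fun h => by
      rw [h, Nat.sub_zero, hgM] at h₁; simp at h₁
    refine ⟨M - Nat.find hex, by omega, h₁, fun j hj hjM => ?_⟩
    have := Nat.find_min hex (show M - j < Nat.find hex by omega)
    rw [Nat.sub_sub_self hjM] at this
    simpa using this
  have hab : a ≤ b := by
    by_contra hlt
    have := hfg a (by omega)
    rw [hfa a le_rfl, hgb' a (by omega) (by omega)] at this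
    simp at this
  set F : ℕ → ℕ := fun j => if f j = f (j + 1) then 0 else M - j with hF
  set H : ℕ → ℕ := fun j => if g j = g (j + 1) then 0 else j + 1 with hH
  have hsum : chainCost M f g = ∑ j ∈ Finset.range M, F j + ∑ j ∈ Finset.range M, H j :=
    Finset.sum_add_distrib
  have hFa : F a = M - a := by simp [hF, hfa a le_rfl, hfa']
  have hHb : H b = b + 1 := by simp [hH, hgb, hgb' (b + 1) (by omega) (by omega)]
  have h₁ : F a ≤ ∑ j ∈ Finset.range M, F j :=
    Finset.single_le_sum (fun _ _ => Nat.zero_le _) (Finset.mem_range.2 haM)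
  have h₂ : H b ≤ ∑ j ∈ Finset.range M, H j :=
    Finset.single_le_sum (fun _ _ => Nat.zero_le _) (Finset.mem_range.2 hbM)
  refine ⟨by omega, fun hle => ?_⟩
  obtain rfl : a = b := by omega
  have hf' : ∀ j < M, j ≠ a → f j = f (j + 1) := by
    intro j hj hja
    have := add_le_sum_of_ne F (Finset.mem_range.2 hj) (Finset.mem_range.2 haM) hja
    have h0 : F j = 0 := by omega
    by_contra hne
    simp only [hF, if_neg hne] at h0
    omega
  have hg' : ∀ j < M, j ≠ a → g j = g (j + 1) := by
    intro j hj hja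
    have := add_le_sum_of_ne H (Finset.mem_range.2 hj) (Finset.mem_range.2 haM) hja
    have h0 : H j = 0 := by omega
    by_contra hne
    simp only [hH, if_neg hne] at h0
    omega
  have hfr : ∀ d, a + 1 + d ≤ M → f (a + 1 + d) = false := by
    intro d
    induction d with
    | zero => intro _; exact hfa'
    | succ d ih =>
      intro hd
      rw [← Nat.add_assoc, ← hf' (a + 1 + d) (by omega) (by omega)]
      exact ih (by omega)
  have hgl : ∀ d ≤ a, g (a - d) = false := by
    intro d
    induction d with
    | zero => intro _; exact hgb
    | succ d ih =>
      intro hd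
      rw [hg' (a - (d + 1)) (by omega) (by omega), show a - (d + 1) + 1 = a - d by omega]
      exact ih (by omega)
  refine ⟨a, haM, fun j hj => ?_⟩
  by_cases hja : j ≤ a
  · refine ⟨by simp [hfa j hja, hja], ?_⟩
    have := hgl (a - j) (by omega)
    rw [Nat.sub_sub_self hja] at this
    simp [this, hja]
  · refine ⟨?_, by simp [hgb' j (by omega) hj, show a < j by omega]⟩
    have := hfr (j - (a + 1)) (by omega)
    rw [show a + 1 + (j - (a + 1)) = j by omega] at this
    simp [this, hja]

/-! ### Equivalence of the constraint satisfaction problem and the hard instance. -/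

namespace Gadgets

variable {Γ : ConstraintLang} (G : Gadgets Γ)

/-- Cut both chains of `(p, q)` at `σ p * N + σ q`. The crisp part costs nothing, the cost of the
chains does not depend on `σ`, and for each pair only the bundle at `(σ p, σ q)` can be violated. -/
theorem hardInst_yes_of_solution {K N : ℕ} {A : ℕ → ℕ → ℕ → ℕ → Bool} {σ : ℕ → ℕ}
    (hσ : ∀ p < K, σ p < N) (hA : ∀ p < K, ∀ q < K, A p q (σ p) (σ q) = true) :
    (weightedMinSAT Γ).Yes (G.hardInst K N A) := by
  obtain ⟨α, hα, hβ⟩ := G.exists_canonical fun t a b c =>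
    if t = 0 then false else if t = 1 then true else
    if t = 2 then decide (c ≤ σ a * N + σ b) else
    if t = 3 then decide (σ a * N + σ b < c) else decide (b ≤ σ a)
  have hzero : α zeroVar = false := hβ _ _ _ _ (by omega)
  have hone : α oneVar = true := hβ _ _ _ _ (by omega)
  have hpos : ∀ p q j, α (posVar p q j) = decide (j ≤ σ p * N + σ q) :=
    fun p q j => hβ _ _ _ _ (by omega)
  have hneg : ∀ p q j, α (negVar p q j) = decide (σ p * N + σ q < j) :=
    fun p q j => hβ _ _ _ _ (by omega)
  have hsel : ∀ p u, α (selVar p u) = decide (u ≤ σ p) := fun p u => hβ _ _ _ _ (by omega)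
  have hcompl : ∀ p q j, α (negVar p q j) = !α (posVar p q j) := by
    intro p q j
    rw [hpos, hneg, ← decide_not, decide_eq_decide]; omega
  have crisp : ∀ θ w, 0 < w → totalCost θ α (G.crispPart K N w) = 0 := by
    intro θ w hw
    have eq0 : ∀ x y, IsMainVar x → IsMainVar y → α x = α y →
        totalCost θ α (G.eqC x y w) = 0 := by
      intro x y hx hy h
      rw [hα.totalCost_eqC θ hw hx hy, if_pos h]
    have hO : α ∘ ![zeroVar, oneVar] = ![false, true] := by
      ext i; fin_cases i
      exacts [hzero, hone]
    simp only [crispPart, totalCost_append, totalCost_flatMap_range]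
    rw [hα.totalCost_nandC θ hw isMainVar_zeroVar isMainVar_zeroVar (by simp [hzero]),
      totalCost_placeFormula _ _ _ _ hw, hO, G.one_sol, mul_zero, add_zero, zero_add]
    refine Finset.sum_eq_zero fun p hp => Finset.sum_eq_zero fun q hq => ?_
    have hp := hσ p (Finset.mem_range.1 hp)
    have hq := hσ q (Finset.mem_range.1 hq)
    have hlt := mul_add_lt_mul hp hq
    have hnand : ∀ j ∈ Finset.range (N * N + 1),
        totalCost θ α (G.nandC (posVar p q j) (negVar p q j) w) = 0 := fun j _ =>
      hα.totalCost_nandC θ hw (isMainVar_posVar ..) (isMainVar_negVar ..) (by rw [hcompl]; simp)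
    rw [eq0 _ _ (isMainVar_posVar ..) isMainVar_oneVar (by simp [hpos, hone]),
      eq0 _ _ (isMainVar_posVar ..) isMainVar_zeroVar (by simp [hpos, hzero, hlt]),
      eq0 _ _ (isMainVar_negVar ..) isMainVar_zeroVar (by simp [hneg, hzero]),
      eq0 _ _ (isMainVar_negVar ..) isMainVar_oneVar (by simp [hneg, hone, hlt]),
      Finset.sum_eq_zero hnand]
    simp only [zero_add]
    refine Finset.sum_eq_zero fun u _ => eq0 _ _ (isMainVar_selVar ..) (isMainVar_posVar ..) ?_
    rw [hsel, hpos, decide_eq_decide]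
    constructor
    · intro h; nlinarith
    · intro h
      by_contra hlt
      nlinarith
  have chain : ∀ θ : ℕ → ℕ, totalCost θ α (G.chainPart K N) = ∑ p ∈ Finset.range K,
      ∑ q ∈ Finset.range K, (θ ((K * K + 1) * (N * N - (σ p * N + σ q))) * G.c +
        θ ((K * K + 1) * (σ p * N + σ q + 1)) * G.c) := by
    intro θ
    simp only [chainPart, totalCost_append, totalCost_flatMap_range]
    refine Finset.sum_congr rfl fun p hp => Finset.sum_congr rfl fun q hq => ?_
    have hp := hσ p (Finset.mem_range.1 hp)
    have hq := hσ q (Finset.mem_range.1 hq)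
    have hlt := mul_add_lt_mul hp hq
    have hw₁ : ∀ j, j < N * N → 0 < (K * K + 1) * (N * N - j) := fun j hj =>
      Nat.mul_pos (by omega) (by omega)
    have hw₂ : ∀ j, 0 < (K * K + 1) * (j + 1) := fun j => Nat.mul_pos (by omega) (by omega)
    rw [Finset.sum_eq_single (σ p * N + σ q)]
    · rw [hα.totalCost_eqC θ (hw₁ _ hlt) (isMainVar_posVar ..) (isMainVar_posVar ..),
        hα.totalCost_eqC θ (hw₂ _) (isMainVar_negVar ..) (isMainVar_negVar ..),
        if_neg (by simp [hpos]), if_neg (by simp [hneg])]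
    · intro j hj hne
      rw [hα.totalCost_eqC θ (hw₁ _ (Finset.mem_range.1 hj)) (isMainVar_posVar ..)
        (isMainVar_posVar ..), hα.totalCost_eqC θ (hw₂ _) (isMainVar_negVar ..)
        (isMainVar_negVar ..), hpos, hpos, hneg, hneg, decide_le_succ_eq hne,
        decide_lt_succ_eq hne]
      simp
    · intro h
      exact absurd (Finset.mem_range.2 hlt) h
  have bundle : ∀ θ w, 0 < w → totalCost θ α (G.bundlePart K N A w) ≤ K * K * θ 1 := by
    intro θ w hw
    simp only [bundlePart, totalCost_flatMap_range]
    have : K * K * θ 1 = ∑ p ∈ Finset.range K, ∑ q ∈ Finset.range K, θ 1 := by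
      simp [mul_assoc]
    rw [this]
    refine Finset.sum_le_sum fun p hp => Finset.sum_le_sum fun q hq => ?_
    have hp' := Finset.mem_range.1 hp
    have hq' := Finset.mem_range.1 hq
    have hpN := hσ p hp'
    have hqN := hσ q hq'
    -- By uniqueness of the digits in base `N`, no link of another bundle is cut.
    have zero : ∀ i < N, ∀ j < N, ¬ (i = σ p ∧ j = σ q) →
        α (posVar p q (i * N + j + 1)) = α (posVar p q (i * N + j)) ∧
        α (posVar q p (j * N + i + 1)) = α (posVar q p (j * N + i)) := by
      intro i hi j hj hne
      simp only [hpos]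
      exact ⟨decide_le_succ_eq fun h => hne (mul_add_inj hj hqN h),
        decide_le_succ_eq fun h => hne (mul_add_inj hi hpN h).symm⟩
    rw [Finset.sum_eq_single (σ p), Finset.sum_eq_single (σ q)]
    · rw [hA p hp' q hq', cond_true]
      exact totalCost_bundleC_le θ
    · intro j hj hne
      have hz := zero (σ p) hpN j (Finset.mem_range.1 hj) (fun h => hne h.2)
      cases A p q (σ p) j
      · rw [cond_false, totalCost_append, hα.totalCost_eqC θ hw (isMainVar_posVar ..)
          (isMainVar_posVar ..), hα.totalCost_eqC θ hw (isMainVar_posVar ..)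
          (isMainVar_posVar ..), if_pos hz.1.symm, if_pos hz.2.symm, add_zero]
      · exact hα.totalCost_bundleC θ (isMainVar_posVar ..) (isMainVar_posVar ..)
          (hcompl ..) (hcompl ..) (hcompl ..) (hcompl ..) hz.1 hz.2
    · intro h
      exact absurd (Finset.mem_range.2 hqN) h
    · intro i hi hne
      refine Finset.sum_eq_zero fun j hj => ?_
      have hz := zero i (Finset.mem_range.1 hi) j (Finset.mem_range.1 hj) (fun h => hne h.1)
      cases A p q i j
      · rw [cond_false, totalCost_append, hα.totalCost_eqC θ hw (isMainVar_posVar ..)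
          (isMainVar_posVar ..), hα.totalCost_eqC θ hw (isMainVar_posVar ..)
          (isMainVar_posVar ..), if_pos hz.1.symm, if_pos hz.2.symm, add_zero]
      · exact hα.totalCost_bundleC θ (isMainVar_posVar ..) (isMainVar_posVar ..)
          (hcompl ..) (hcompl ..) (hcompl ..) (hcompl ..) hz.1 hz.2
    · intro h
      exact absurd (Finset.mem_range.2 hpN) h
  rw [weightedMinSAT_yes_iff]
  refine ⟨α, ?_, ?_⟩
  · simp only [hardInst, totalCost_append, crisp _ _ (Nat.succ_pos _), chain, boundK]
    have := bundle (fun _ => 1) (G.boundW K N + 1) (Nat.succ_pos _)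
    simp only [Finset.sum_const, Finset.card_range, smul_eq_mul] at this ⊢
    have e : K * (K * (1 * G.c + 1 * G.c)) = K * K * (2 * G.c) := by ring
    omega
  · simp only [hardInst, totalCost_append, crisp _ _ (Nat.succ_pos _), chain]
    have := bundle (fun w => w) (G.boundW K N + 1) (Nat.succ_pos _)
    have e : ∑ p ∈ Finset.range K, ∑ q ∈ Finset.range K,
        ((K * K + 1) * (N * N - (σ p * N + σ q)) * G.c +
        (K * K + 1) * (σ p * N + σ q + 1) * G.c) =
        K * K * ((K * K + 1) * (G.c * (N * N + 1))) := by
      trans ∑ p ∈ Finset.range K, ∑ q ∈ Finset.range K, (K * K + 1) * (G.c * (N * N + 1))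
      · refine Finset.sum_congr rfl fun p hp => Finset.sum_congr rfl fun q hq => ?_
        have hlt := mul_add_lt_mul (hσ p (Finset.mem_range.1 hp)) (hσ q (Finset.mem_range.1 hq))
        rw [← add_mul, ← mul_add]
        have : N * N - (σ p * N + σ q) + (σ p * N + σ q + 1) = N * N + 1 := by omega
        rw [this]; ring
      · simp [mul_assoc]
    rw [e]
    change _ ≤ K * K * ((K * K + 1) * (G.c * (N * N + 1))) + K * K
    omega

/-- The weight bound forces the whole structure: crisp constraints hold, every pair of chains has
minimal cost, and exactly one unit is spent on the bundles of each pair. The solution is read off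
from the leading digit of the cut of `(p, p)`. -/
theorem exists_solution_of_hardInst_yes {K N : ℕ} {A : ℕ → ℕ → ℕ → ℕ → Bool}
    (h : (weightedMinSAT Γ).Yes (G.hardInst K N A)) :
    ∃ σ : ℕ → ℕ, (∀ p < K, σ p < N) ∧ ∀ p < K, ∀ q < K, A p q (σ p) (σ q) = true := by
  rw [weightedMinSAT_yes_iff] at h
  obtain ⟨α, -, h⟩ := h
  change totalCost (fun w => w) α (G.crispPart K N (G.boundW K N + 1) ++ G.chainPart K N ++
    G.bundlePart K N A (G.boundW K N + 1)) ≤ G.boundW K N at h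
  rw [totalCost_append, totalCost_append] at h
  have hc := G.c_pos
  obtain ⟨W, hW⟩ : ∃ W, W = G.boundW K N := ⟨_, rfl⟩
  rw [← hW] at h
  have hw : 0 < W + 1 := Nat.succ_pos _
  have crisp_eq : ∀ x y, totalCost (fun w => w) α (G.eqC x y (W + 1)) ≤ W → α x = α y := by
    intro x y hle
    by_contra hne
    have h₁ : (W + 1) * G.c ≤ _ := le_totalCost_eqC (fun w => w) hw hne
    have h₂ := Nat.le_mul_of_pos_right (W + 1) hc
    omega
  have crisp_nand : ∀ x y, totalCost (fun w => w) α (G.nandC x y (W + 1)) ≤ W →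
      (α x && α y) = false := by
    intro x y hle
    by_contra hne
    simp only [Bool.and_eq_false_iff, not_or, Bool.not_eq_false] at hne
    have h₁ : W + 1 ≤ _ := le_totalCost_nandC (G := G) (fun w => w) hw hne.1 hne.2
    omega
  have hcrisp : totalCost (fun w => w) α (G.crispPart K N (W + 1)) ≤ W := by omega
  simp only [crispPart, totalCost_append, totalCost_flatMap_range] at hcrisp
  have hzero : α zeroVar = false := by
    have := crisp_nand zeroVar zeroVar (by omega)
    simpa using this
  have hone : α oneVar = true := by
    by_contra hne
    have h₁ : totalCost (fun w => w) α (placeFormula G.oneF ![zeroVar, oneVar] (W + 1)) ≤ W := by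
      omega
    have hO : α ∘ ![zeroVar, oneVar] = ![false, false] := by
      ext i; fin_cases i
      exacts [hzero, by simpa using hne]
    rw [totalCost_placeFormula _ _ _ _ hw, hO] at h₁
    have h₂ := Nat.le_mul_of_pos_right (W + 1) G.le_one
    omega
  let S := Finset.range K ×ˢ Finset.range K
  have hS : S.card = K * K := by simp [S]
  have hcr : ∀ p < K, ∀ q < K,
      α (posVar p q 0) = true ∧ α (posVar p q (N * N)) = false ∧
      α (negVar p q (N * N)) = true ∧
      (∀ j ≤ N * N, (α (posVar p q j) && α (negVar p q j)) = false) ∧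
      ∀ u < N, α (selVar p u) = α (posVar p q (u * N)) := by
    intro p hp q hq
    rw [← Finset.sum_product'] at hcrisp
    have hle := (Finset.single_le_sum (fun _ _ => Nat.zero_le _)
      (show (p, q) ∈ S from Finset.mk_mem_product (Finset.mem_range.2 hp)
        (Finset.mem_range.2 hq))).trans ((Nat.le_add_left _ _).trans hcrisp)
    simp only at hle
    refine ⟨?_, ?_, ?_, fun j hj => ?_, fun u hu => ?_⟩
    · rw [crisp_eq (posVar p q 0) oneVar (by omega), hone]
    · rw [crisp_eq (posVar p q (N * N)) zeroVar (by omega), hzero]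
    · rw [crisp_eq (negVar p q (N * N)) oneVar (by omega), hone]
    · refine crisp_nand _ _ ?_
      have := Finset.single_le_sum (f := fun j => totalCost (fun w => w) α
        (G.nandC (posVar p q j) (negVar p q j) (W + 1))) (fun _ _ => Nat.zero_le _)
        (Finset.mem_range.2 (Nat.lt_add_one_of_le hj))
      omega
    · refine crisp_eq _ _ ?_
      have := Finset.single_le_sum (f := fun u => totalCost (fun w => w) α
        (G.eqC (selVar p u) (posVar p q (u * N)) (W + 1))) (fun _ _ => Nat.zero_le _)
        (Finset.mem_range.2 hu)
      omega
  have hWeq : W = S.card * ((K * K + 1) * (G.c * (N * N + 1))) + K * K := by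
    rw [hW, hS]; rfl
  obtain ⟨Ch, hCh⟩ : ∃ Ch : ℕ × ℕ → ℕ, totalCost (fun w => w) α (G.chainPart K N) =
      ∑ x ∈ S, Ch x ∧ ∀ p q, (K * K + 1) * (G.c * chainCost (N * N) (fun j => α (posVar p q j))
        (fun j => α (negVar p q j))) ≤ Ch (p, q) := by
    simp only [chainPart, totalCost_append, totalCost_flatMap_range]
    refine ⟨fun x => _, (Finset.sum_product' _ _ _).symm, fun p q => ?_⟩
    simp only [chainCost]
    rw [Finset.mul_sum, Finset.mul_sum]
    refine Finset.sum_le_sum fun j hj => ?_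
    have hj := Finset.mem_range.1 hj
    rw [mul_add, mul_add]
    refine Nat.add_le_add ?_ ?_
    · split_ifs with heq
      · simp
      · refine le_trans (le_of_eq ?_) (le_totalCost_eqC (fun w => w)
          (Nat.mul_pos (Nat.succ_pos _) (by omega)) heq)
        ring
    · split_ifs with heq
      · simp
      · refine le_trans (le_of_eq ?_) (le_totalCost_eqC (fun w => w)
          (Nat.mul_pos (Nat.succ_pos _) (by omega)) heq)
        ring
  have hmem : ∀ {p q}, p < K → q < K → (p, q) ∈ S := fun hp hq =>
    Finset.mk_mem_product (Finset.mem_range.2 hp) (Finset.mem_range.2 hq)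
  have hChle : ∀ x ∈ S, (K * K + 1) * (G.c * (N * N + 1)) ≤ Ch x := by
    rintro ⟨p, q⟩ hx
    have hx := Finset.mem_product.1 hx
    obtain ⟨h₁, h₂, h₃, h₄, -⟩ := hcr p (Finset.mem_range.1 hx.1) q (Finset.mem_range.1 hx.2)
    exact (Nat.mul_le_mul_left _ (Nat.mul_le_mul_left _ (le_chainCost
      (f := fun j => α (posVar p q j)) (g := fun j => α (negVar p q j)) h₁ h₂ h₃ h₄).1)).trans
      (hCh.2 p q)
  have hcut : ∀ p q, ∃ a, p < K → q < K → a < N * N ∧ ∀ j ≤ N * N,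
      α (posVar p q j) = decide (j ≤ a) ∧ α (negVar p q j) = decide (a < j) := by
    intro p q
    by_cases hpq : p < K ∧ q < K
    · obtain ⟨hp, hq⟩ := hpq
      obtain ⟨h₁, h₂, h₃, h₄, -⟩ := hcr p hp q hq
      have hle := le_add_of_sum_le hChle (show _ ≤ _ + K * K by rw [← hCh.1]; omega) (hmem hp hq)
      have hle' := (hCh.2 p q).trans hle
      obtain ⟨a, ha, ha'⟩ := (le_chainCost (f := fun j => α (posVar p q j))
        (g := fun j => α (negVar p q j)) h₁ h₂ h₃ h₄).2 (by
        -- One unit above the minimum would add at least `(K² + 1) * c`, more than the slack `K²`.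
        by_contra hlt
        have h₅ := Nat.mul_le_mul_left (K * K + 1) (Nat.mul_le_mul_left G.c
          (show N * N + 1 + 1 ≤ _ by exact Nat.lt_of_not_le hlt))
        have h₆ : (K * K + 1) * (G.c * (N * N + 1 + 1)) =
          (K * K + 1) * (G.c * (N * N + 1)) + (K * K + 1) * G.c := by ring
        have h₇ := Nat.le_mul_of_pos_right (K * K + 1) hc
        omega)
      exact ⟨a, fun _ _ => ⟨ha, ha'⟩⟩
    · exact ⟨0, fun hp hq => absurd ⟨hp, hq⟩ hpq⟩
  choose a ha using hcut
  have hcompl : ∀ p < K, ∀ q < K, ∀ j ≤ N * N, α (negVar p q j) = !α (posVar p q j) := by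
    intro p hp q hq j hj
    obtain ⟨h₁, h₂⟩ := (ha p q hp hq).2 j hj
    rw [h₁, h₂, ← decide_not, decide_eq_decide]; omega
  -- `B` is the cost of a single bundle. One that contains a cut costs at least 1 if its values are
  -- allowed, and more than `W` otherwise.
  obtain ⟨B, hB⟩ : ∃ B : ℕ × ℕ → ℕ × ℕ → ℕ,
      totalCost (fun w => w) α (G.bundlePart K N A (W + 1)) =
        ∑ x ∈ S, ∑ y ∈ Finset.range N ×ˢ Finset.range N, B x y ∧
      ∀ p < K, ∀ q < K, ∀ i < N, ∀ j < N,
        (a p q = i * N + j ∨ a q p = j * N + i) → B (p, q) (i, j) ≤ W →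
        1 ≤ B (p, q) (i, j) ∧ A p q i j = true := by
    refine ⟨fun x y => totalCost (fun w => w) α (bif A x.1 x.2 y.1 y.2 then
        G.bundleC (posVar x.1 x.2 (y.1 * N + y.2)) (posVar x.1 x.2 (y.1 * N + y.2 + 1))
          (posVar x.2 x.1 (y.2 * N + y.1)) (posVar x.2 x.1 (y.2 * N + y.1 + 1))
          (negVar x.1 x.2 (y.1 * N + y.2)) (negVar x.1 x.2 (y.1 * N + y.2 + 1))
          (negVar x.2 x.1 (y.2 * N + y.1)) (negVar x.2 x.1 (y.2 * N + y.1 + 1))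
      else
        G.eqC (posVar x.1 x.2 (y.1 * N + y.2)) (posVar x.1 x.2 (y.1 * N + y.2 + 1)) (W + 1) ++
        G.eqC (posVar x.2 x.1 (y.2 * N + y.1)) (posVar x.2 x.1 (y.2 * N + y.1 + 1)) (W + 1)),
      ?_, ?_⟩
    · simp only [bundlePart, totalCost_flatMap_range, S, Finset.sum_product]
    · intro p hp q hq i hi j hj hij
      have hl₁ := mul_add_lt_mul hi hj
      have hl₂ := mul_add_lt_mul hj hi
      have hdrop : (α (posVar p q (i * N + j)) = true ∧ α (posVar p q (i * N + j + 1)) = false) ∨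
          (α (posVar q p (j * N + i)) = true ∧ α (posVar q p (j * N + i + 1)) = false) := by
        rcases hij with hij | hij
        · left
          rw [((ha p q hp hq).2 _ hl₁.le).1, ((ha p q hp hq).2 _ hl₁).1, hij]
          simp
        · right
          rw [((ha q p hq hp).2 _ hl₂.le).1, ((ha q p hq hp).2 _ hl₂).1, hij]
          simp
      cases hA : A p q i j
      · intro hle
        simp only [hA, cond_false, totalCost_append] at hle
        have e₁ := crisp_eq (posVar p q (i * N + j)) (posVar p q (i * N + j + 1)) (by omega)
        have e₂ := crisp_eq (posVar q p (j * N + i)) (posVar q p (j * N + i + 1)) (by omega)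
        rw [e₁, e₂] at hdrop
        rcases hdrop with ⟨h₁, h₂⟩ | ⟨h₁, h₂⟩ <;> simp [h₁] at h₂
      · intro _
        refine ⟨?_, rfl⟩
        simp only [hA, cond_true]
        exact le_totalCost_bundleC (fun w => w) (hcompl p hp q hq _ hl₁.le)
          (hcompl p hp q hq _ hl₁) (hcompl q hq p hp _ hl₂.le) (hcompl q hq p hp _ hl₂) hdrop
  rw [← hW] at *
  have hdiv : ∀ p < K, ∀ q < K, a p q / N < N ∧ a p q % N < N ∧
      a p q = a p q / N * N + a p q % N := by
    intro p hp q hq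
    have hlt := (ha p q hp hq).1
    have hN : 0 < N := by
      rcases Nat.eq_zero_or_pos N with rfl | hN
      · simp at hlt
      · exact hN
    exact ⟨Nat.div_lt_of_lt_mul hlt, Nat.mod_lt _ hN, (Nat.div_add_mod' _ _).symm⟩
  have hBW : ∀ p < K, ∀ q < K, ∑ y ∈ Finset.range N ×ˢ Finset.range N, B (p, q) y ≤ W := by
    intro p hp q hq
    have := Finset.single_le_sum (f := fun x => ∑ y ∈ Finset.range N ×ˢ Finset.range N, B x y)
      (fun _ _ => Nat.zero_le _) (hmem hp hq)
    omega
  have hterm : ∀ p < K, ∀ q < K, ∀ i < N, ∀ j < N,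
      (a p q = i * N + j ∨ a q p = j * N + i) → 1 ≤ B (p, q) (i, j) ∧ A p q i j = true := by
    intro p hp q hq i hi j hj hij
    refine hB.2 p hp q hq i hi j hj hij (le_trans ?_ (hBW p hp q hq))
    exact Finset.single_le_sum (f := fun y => B (p, q) y) (fun _ _ => Nat.zero_le _)
      (Finset.mk_mem_product (Finset.mem_range.2 hi) (Finset.mem_range.2 hj))
  have hBone : ∀ x ∈ S, 1 ≤ ∑ y ∈ Finset.range N ×ˢ Finset.range N, B x y := by
    rintro ⟨p, q⟩ hx
    have hx := Finset.mem_product.1 hx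
    have hp := Finset.mem_range.1 hx.1
    have hq := Finset.mem_range.1 hx.2
    obtain ⟨h₁, h₂, h₃⟩ := hdiv p hp q hq
    refine (hterm p hp q hq _ h₁ _ h₂ (.inl h₃)).1.trans ?_
    exact Finset.single_le_sum (f := fun y => B (p, q) y) (fun _ _ => Nat.zero_le _)
      (Finset.mk_mem_product (Finset.mem_range.2 h₁) (Finset.mem_range.2 h₂))
  -- The chains leave at most `K²` for the bundles. Each of the `K²` pairs needs at least 1, so the
  -- slack is 0.
  have hBle : ∀ p < K, ∀ q < K, ∑ y ∈ Finset.range N ×ˢ Finset.range N, B (p, q) y ≤ 1 := by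
    intro p hp q hq
    have h₁ := Finset.card_nsmul_le_sum S Ch _ hChle
    rw [smul_eq_mul, ← hCh.1] at h₁
    exact le_add_of_sum_le (e := 0) hBone (by rw [← hB.1]; omega) (hmem hp hq)
  -- The cut of `(p, q)` lies in the bundle of its digits, that of `(q, p)` in the bundle of its
  -- swapped digits. Two different bundles would cost 2.
  have hswap : ∀ p < K, ∀ q < K, a p q / N = a q p % N ∧ a p q % N = a q p / N := by
    intro p hp q hq
    obtain ⟨h₁, h₂, h₃⟩ := hdiv p hp q hq
    obtain ⟨h₁', h₂', h₃'⟩ := hdiv q hq p hp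
    have e₁ := (hterm p hp q hq _ h₁ _ h₂ (.inl h₃)).1
    have e₂ := (hterm p hp q hq _ h₂' _ h₁' (.inr h₃')).1
    by_contra hne
    have hne' : (a p q / N, a p q % N) ≠ (a q p % N, a q p / N) := fun h =>
      hne (Prod.mk.inj h)
    have h₅ := add_le_sum_of_ne (B (p, q))
      (Finset.mk_mem_product (Finset.mem_range.2 h₁) (Finset.mem_range.2 h₂))
      (Finset.mk_mem_product (Finset.mem_range.2 h₂') (Finset.mem_range.2 h₁')) hne'
    have h₆ := hBle p hp q hq
    omega
  -- For `u = a p q / N` the selector of `p` is true by the chain of `(p, q)`; the chain of `(p,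
  -- q')` must then be cut at `u * N` or later.
  have hsel : ∀ p < K, ∀ q < K, ∀ q' < K, a p q / N ≤ a p q' / N := by
    intro p hp q hq q' hq'
    obtain ⟨h₁, h₂, h₃⟩ := hdiv p hp q hq
    have e := ((hcr p hp q hq).2.2.2.2 _ h₁).symm.trans ((hcr p hp q' hq').2.2.2.2 _ h₁)
    have hle : a p q / N * N ≤ N * N := Nat.mul_le_mul_right _ h₁.le
    rw [((ha p q hp hq).2 _ hle).1, ((ha p q' hp hq').2 _ hle).1, decide_eq_decide] at e
    exact (Nat.le_div_iff_mul_le (by omega)).2 (e.1 (by omega))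
  have hval : ∀ p < K, ∀ q < K, a p q / N = a p p / N := fun p hp q hq =>
    le_antisymm (hsel p hp q hq p hp) (hsel p hp p hp q hq)
  refine ⟨fun p => a p p / N, fun p hp => (hdiv p hp p hp).1, fun p hp q hq => ?_⟩
  obtain ⟨h₁, h₂, h₃⟩ := hdiv p hp q hq
  have := (hterm p hp q hq _ h₁ _ h₂ (.inl h₃)).2
  rwa [(hswap p hp q hq).2, hval p hp q hq, hval q hq p hp] at this

end Gadgets

/-! ## Weighted satisfiability as a binary constraint satisfaction problem -/

/-- All lists of length `n` with entries from `l`. -/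
def listTuples {α : Type} (l : List α) : ℕ → List (List α)
  | 0 => [[]]
  | n + 1 => l.flatMap fun a => (listTuples l n).map fun t => a :: t

theorem mem_listTuples {α : Type} {l : List α} {n : ℕ} {t : List α} :
    t ∈ listTuples l n ↔ t.length = n ∧ ∀ a ∈ t, a ∈ l := by
  induction n generalizing t with
  | zero => cases t <;> simp [listTuples]
  | succ n ih =>
    cases t with
    | nil => simp [listTuples]
    | cons a t => simp [listTuples, ih]; tauto

/-- The partial list `ρ` of pairs `(i, a)`, where `a` is one plus the `i`-th true variable (and
zero for `i = 0`), suffices to see that the literal `l` is false. -/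
def knownFalse (k : ℕ) (ρ : List (ℕ × ℕ)) (l : Literal) : Bool :=
  bif l.2 then
    ρ.any fun x => ρ.any fun y => decide (x.2 ≤ l.1) &&
      ((decide (y.1 = x.1 + 1) && decide (l.1 + 2 ≤ y.2)) || (decide (x.1 = k) && decide (y.1 = 0)))
  else ρ.any fun x => decide (x.2 = l.1 + 1)

/-- The partial lists `ρ` and `τ`, with indices `I` and `J`, are increasing and agree, and `ρ`
does not falsify a clause of `φ`. -/
def compatible (φ : CNF) (k : ℕ) (I J : List ℕ) (ρ τ : List (ℕ × ℕ)) : Bool :=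
  decide (ρ.map (fun x => x.1) = I) && decide (τ.map (fun x => x.1) = J) &&
  (ρ.all fun x => τ.all fun y =>
    (!decide (x.1 = y.1) || decide (x.2 = y.2)) &&
    (!decide (x.1 + 1 ≤ y.1) || decide (x.2 + 1 ≤ y.2))) &&
  (ρ.all fun x => !decide (x.1 = 0) || decide (x.2 = 0)) &&
  φ.all fun C => !(C.all fun l => knownFalse k ρ l)

/-- The possible indices. -/
def indexTuples (k D : ℕ) : List (List ℕ) := listTuples (List.range (k + 1)) D

/-- The possible partial lists. -/
def valueTuples (φ : CNF) (k D : ℕ) : List (List (ℕ × ℕ)) :=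
  listTuples ((List.range (k + 1)).flatMap fun i =>
    (0 :: φ.flatMap fun C => C.map fun l => l.1 + 1).map fun a => (i, a)) D

/-- The relation `compatible` on the positions in the lists of indices and of partial lists. -/
def allowed (φ : CNF) (k D : ℕ) (p q i j : ℕ) : Bool :=
  compatible φ k ((indexTuples k D).getD p []) ((indexTuples k D).getD q [])
    ((valueTuples φ k D).getD i []) ((valueTuples φ k D).getD j [])

theorem mem_indexTuples {k D : ℕ} {I : List ℕ} :
    I ∈ indexTuples k D ↔ I.length = D ∧ ∀ i ∈ I, i ≤ k := by
  simp [indexTuples, mem_listTuples]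

theorem CNF.mem_vars {φ : CNF} {v : ℕ} : v ∈ φ.vars ↔ ∃ C ∈ φ, ∃ l ∈ C, l.1 = v := by
  simp only [CNF.vars, List.mem_toFinset, List.mem_map, List.mem_flatten]
  constructor
  · rintro ⟨l, ⟨C, hC, hl⟩, rfl⟩; exact ⟨C, hC, l, hl, rfl⟩
  · rintro ⟨C, hC, l, hl, rfl⟩; exact ⟨l, ⟨C, hC, hl⟩, rfl⟩

theorem mem_valueTuples {φ : CNF} {k D : ℕ} {ρ : List (ℕ × ℕ)} :
    ρ ∈ valueTuples φ k D ↔ ρ.length = D ∧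
      ∀ x ∈ ρ, x.1 ≤ k ∧ (x.2 = 0 ∨ ∃ v ∈ φ.vars, x.2 = v + 1) := by
  have : ∀ x : ℕ × ℕ, (x ∈ (List.range (k + 1)).flatMap fun i =>
      (0 :: φ.flatMap fun C => C.map fun l => l.1 + 1).map fun a => (i, a)) ↔
      x.1 ≤ k ∧ (x.2 = 0 ∨ ∃ v ∈ φ.vars, x.2 = v + 1) := by
    rintro ⟨i, a⟩
    simp only [List.mem_flatMap, List.mem_range, List.mem_map, List.mem_cons, Prod.mk.injEq,
      CNF.mem_vars, Nat.lt_succ_iff]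
    constructor
    · rintro ⟨i', hi, a', ha, rfl, rfl⟩
      refine ⟨hi, ha.imp id ?_⟩
      rintro ⟨C, hC, l, hl, rfl⟩
      exact ⟨l.1, ⟨C, hC, l, hl, rfl⟩, rfl⟩
    · rintro ⟨hi, ha⟩
      refine ⟨i, hi, a, ha.imp id ?_, rfl, rfl⟩
      rintro ⟨v, ⟨C, hC, l, hl, rfl⟩, rfl⟩
      exact ⟨C, hC, l, hl, rfl⟩
  rw [valueTuples, mem_listTuples]
  simp only [this]

theorem compatible_iff {φ : CNF} {k : ℕ} {I J : List ℕ} {ρ τ : List (ℕ × ℕ)} :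
    compatible φ k I J ρ τ = true ↔
      ρ.map (fun x => x.1) = I ∧ τ.map (fun x => x.1) = J ∧
      (∀ x ∈ ρ, ∀ y ∈ τ, (x.1 = y.1 → x.2 = y.2) ∧ (x.1 < y.1 → x.2 < y.2)) ∧
      (∀ x ∈ ρ, x.1 = 0 → x.2 = 0) ∧
      ∀ C ∈ φ, ∃ l ∈ C, knownFalse k ρ l = false := by
  simp only [compatible, Bool.and_eq_true, decide_eq_true_eq, List.all_eq_true, Bool.or_eq_true,
    Bool.not_eq_true', decide_eq_false_iff_not, ← imp_iff_not_or, List.all_eq_false,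
    Bool.not_eq_true, and_assoc, Nat.succ_le_iff, ← Nat.succ_eq_add_one]

/-- The list of values may contain repetitions; `idxOf` selects one position of each value. -/
theorem exists_allowed_iff (φ : CNF) (k D : ℕ) :
    (∃ σ : ℕ → ℕ, (∀ p < (indexTuples k D).length, σ p < (valueTuples φ k D).length) ∧
      ∀ p < (indexTuples k D).length, ∀ q < (indexTuples k D).length,
        allowed φ k D p q (σ p) (σ q) = true) ↔
    ∃ τ : List ℕ → List (ℕ × ℕ), (∀ I ∈ indexTuples k D, τ I ∈ valueTuples φ k D) ∧
      ∀ I ∈ indexTuples k D, ∀ J ∈ indexTuples k D,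
        compatible φ k I J (τ I) (τ J) = true := by
  have getD_idxOf : ∀ {β : Type} [BEq β] [LawfulBEq β] (l : List (List β)) (t : List β), t ∈ l →
      l.getD (l.idxOf t) [] = t := by
    intro β _ _ l t ht
    rw [List.getD_eq_getElem _ _ (List.idxOf_lt_length_of_mem ht)]
    exact List.getElem_idxOf _
  have getD_mem : ∀ {β : Type} (l : List (List β)) (p : ℕ), p < l.length → l.getD p [] ∈ l := by
    intro β l p hp
    rw [List.getD_eq_getElem _ _ hp]
    exact List.getElem_mem hp
  constructor
  · rintro ⟨σ, hσ, h⟩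
    refine ⟨fun I => (valueTuples φ k D).getD (σ ((indexTuples k D).idxOf I)) [],
      fun I hI => getD_mem _ _ (hσ _ (List.idxOf_lt_length_of_mem hI)), fun I hI J hJ => ?_⟩
    have := h _ (List.idxOf_lt_length_of_mem hI) _ (List.idxOf_lt_length_of_mem hJ)
    rwa [allowed, getD_idxOf _ _ hI, getD_idxOf _ _ hJ] at this
  · rintro ⟨τ, hτ, h⟩
    refine ⟨fun p => (valueTuples φ k D).idxOf (τ ((indexTuples k D).getD p [])),
      fun p hp => List.idxOf_lt_length_of_mem (hτ _ (getD_mem _ _ hp)), fun p hp q hq => ?_⟩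
    beta_reduce
    rw [allowed, getD_idxOf _ _ (hτ _ (getD_mem _ _ hp)), getD_idxOf _ _ (hτ _ (getD_mem _ _ hq))]
    exact h _ (getD_mem _ _ hp) _ (getD_mem _ _ hq)

theorem knownFalse_pos {k : ℕ} {ρ : List (ℕ × ℕ)} {v : ℕ} :
    knownFalse k ρ (v, true) = true ↔ ∃ x ∈ ρ, ∃ y ∈ ρ, x.2 ≤ v ∧
      ((y.1 = x.1 + 1 ∧ v + 2 ≤ y.2) ∨ (x.1 = k ∧ y.1 = 0)) := by
  simp [knownFalse]

theorem knownFalse_neg {k : ℕ} {ρ : List (ℕ × ℕ)} {v : ℕ} :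
    knownFalse k ρ (v, false) = true ↔ ∃ x ∈ ρ, x.2 = v + 1 := by
  simp only [knownFalse, cond_false, List.any_eq_true, decide_eq_true_eq]

/-- A literal that is false for the set of the numbers `s i - 1`, `1 ≤ i ≤ k`, is seen to be false
from two of the numbers `s i`. -/
theorem exists_knownFalse {k : ℕ} {s : ℕ → ℕ} (h0 : s 0 = 0) {S : Finset ℕ}
    (hS : ∀ v, v ∈ S ↔ ∃ i, 1 ≤ i ∧ i ≤ k ∧ s i = v + 1) (l : Literal)
    (hl : ¬ (l.1 ∈ S ↔ l.2 = true)) :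
    ∃ i ≤ k, ∃ j ≤ k, ∀ ρ : List (ℕ × ℕ), (i, s i) ∈ ρ → (j, s j) ∈ ρ →
      knownFalse k ρ l = true := by
  obtain ⟨v, b⟩ := l
  cases b
  · have hv : v ∈ S := by simpa using hl
    obtain ⟨i, -, hik, hi⟩ := (hS v).1 hv
    exact ⟨i, hik, i, hik, fun ρ h _ => knownFalse_neg.2 ⟨_, h, hi⟩⟩
  · have hv : v ∉ S := by simpa using hl
    -- With `i` the last index such that `s i ≤ v`, the variable `v` lies strictly between two
    -- consecutive true variables, before the first one, or beyond the last one. If `i = k`, the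
    -- second index is the dummy 0.
    have hg := Nat.findGreatest_spec (P := fun i => s i ≤ v) (Nat.zero_le k) (by omega)
    have hgk : Nat.findGreatest (fun i => s i ≤ v) k ≤ k := Nat.findGreatest_le k
    set i := Nat.findGreatest (fun i => s i ≤ v) k with hi
    rcases hgk.eq_or_lt with heq | hlt
    · exact ⟨i, hgk, 0, Nat.zero_le _, fun ρ h₁ h₂ =>
        knownFalse_pos.2 ⟨_, h₁, _, h₂, hg, .inr ⟨heq, rfl⟩⟩⟩
    · have hnext : ¬ s (i + 1) ≤ v := Nat.findGreatest_is_greatest (P := fun i => s i ≤ v)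
        (Nat.lt_succ_self i) hlt
      have hne : s (i + 1) ≠ v + 1 := fun h => hv ((hS v).2 ⟨i + 1, by omega, hlt, h⟩)
      exact ⟨i, hgk, i + 1, hlt, fun ρ h₁ h₂ =>
        knownFalse_pos.2 ⟨_, h₁, _, h₂, hg, .inl ⟨rfl, by simp only; omega⟩⟩⟩

theorem exists_knownFalse_clause {k : ℕ} {s : ℕ → ℕ} (h0 : s 0 = 0) {S : Finset ℕ}
    (hS : ∀ v, v ∈ S ↔ ∃ i, 1 ≤ i ∧ i ≤ k ∧ s i = v + 1) (C : List Literal)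
    (hC : ∀ l ∈ C, ¬ (l.1 ∈ S ↔ l.2 = true)) :
    ∃ I : List ℕ, I.length = 2 * C.length ∧ (∀ i ∈ I, i ≤ k) ∧
      ∀ ρ : List (ℕ × ℕ), (∀ i ∈ I, (i, s i) ∈ ρ) → ∀ l ∈ C, knownFalse k ρ l = true := by
  induction C with
  | nil => exact ⟨[], by simp⟩
  | cons l C ih =>
    obtain ⟨I, hI, hIk, h⟩ := ih fun l hl => hC l (List.mem_cons_of_mem _ hl)
    obtain ⟨i, hi, j, hj, hij⟩ := exists_knownFalse h0 hS l (hC l List.mem_cons_self)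
    refine ⟨i :: j :: I, by simp [hI]; ring, ?_, fun ρ hρ m hm => ?_⟩
    · simpa [hi, hj] using hIk
    · rcases List.mem_cons.1 hm with rfl | hm
      · exact hij ρ (hρ i (by simp)) (hρ j (by simp))
      · exact h ρ (fun i hi => hρ i (by simp [hi])) m hm

/-- A satisfying set gives the restrictions of a single increasing list `s`. Conversely, the
constant tuples define `s`, and consistency with them makes every `τ I` a restriction of `s`. If a
clause were false, at most `2 * d` indices would reveal it, and the tuple of these indices would
fail its own test. -/
theorem exists_satisfying_iff {φ : CNF} {d : ℕ} (hd : 1 ≤ d) (hφ : ∀ C ∈ φ, C.length ≤ d)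
    (k : ℕ) :
    (∃ S : Finset ℕ, S ⊆ φ.vars ∧ S.card = k ∧ φ.SatisfiedBy S) ↔
    ∃ τ : List ℕ → List (ℕ × ℕ),
      (∀ I ∈ indexTuples k (2 * d), τ I ∈ valueTuples φ k (2 * d)) ∧
      ∀ I ∈ indexTuples k (2 * d), ∀ J ∈ indexTuples k (2 * d),
        compatible φ k I J (τ I) (τ J) = true := by
  constructor
  · rintro ⟨S, hS, hcard, hsat⟩
    -- The sentinel `s 0 = 0` lies below all entries, which are shifted by one.
    let s : ℕ → ℕ := fun i =>
      if h : 1 ≤ i ∧ i ≤ k then S.orderEmbOfFin hcard ⟨i - 1, by omega⟩ + 1 else 0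
    have hs0 : s 0 = 0 := by simp [s]
    have hsmem : ∀ i, 1 ≤ i → i ≤ k → ∃ v ∈ S, s i = v + 1 := fun i h₁ h₂ =>
      ⟨_, S.orderEmbOfFin_mem hcard ⟨i - 1, by omega⟩, by simp [s, h₁, h₂]⟩
    have hmono : ∀ i j, i < j → j ≤ k → s i < s j := by
      intro i j hij hj
      rcases Nat.eq_zero_or_pos i with rfl | hi
      · obtain ⟨v, -, h⟩ := hsmem j hij hj
        omega
      · have hij' : S.orderEmbOfFin hcard ⟨i - 1, by omega⟩ <
            S.orderEmbOfFin hcard ⟨j - 1, by omega⟩ :=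
          (S.orderEmbOfFin hcard).strictMono (by rw [Fin.mk_lt_mk]; omega)
        simp only [s, show 1 ≤ i ∧ i ≤ k by omega, show 1 ≤ j ∧ j ≤ k by omega, and_self, dif_pos]
        omega
    have hsurj : ∀ v ∈ S, ∃ i, 1 ≤ i ∧ i ≤ k ∧ s i = v + 1 := by
      intro v hv
      have : v ∈ Set.range (S.orderEmbOfFin hcard) := by
        rw [Finset.range_orderEmbOfFin]; exact hv
      obtain ⟨⟨i, hi⟩, rfl⟩ := this
      exact ⟨i + 1, by omega, by omega, by simp [s, show i + 1 ≤ k by omega]⟩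
    refine ⟨fun I => I.map fun i => (i, s i), fun I hI => ?_, fun I hI J hJ => ?_⟩
    · obtain ⟨hl, hI⟩ := mem_indexTuples.1 hI
      refine mem_valueTuples.2 ⟨by simpa using hl, fun x hx => ?_⟩
      obtain ⟨i, hi, rfl⟩ := List.mem_map.1 hx
      refine ⟨hI i hi, ?_⟩
      rcases Nat.eq_zero_or_pos i with rfl | h
      · exact .inl hs0
      · obtain ⟨v, hv, h⟩ := hsmem i h (hI i hi)
        exact .inr ⟨v, hS hv, h⟩
    · obtain ⟨-, hI⟩ := mem_indexTuples.1 hI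
      obtain ⟨-, hJ⟩ := mem_indexTuples.1 hJ
      refine compatible_iff.2 ⟨by rw [List.map_map]; exact List.map_id _,
        by rw [List.map_map]; exact List.map_id _, ?_, ?_, fun C hC => ?_⟩
      · intro x hx y hy
        obtain ⟨i, hi, rfl⟩ := List.mem_map.1 hx
        obtain ⟨j, hj, rfl⟩ := List.mem_map.1 hy
        exact ⟨fun h => congrArg s h, fun h => hmono i j h (hJ j hj)⟩
      · intro x hx h
        obtain ⟨i, hi, rfl⟩ := List.mem_map.1 hx
        simp only at h
        subst h
        exact hs0
      · obtain ⟨⟨v, b⟩, hl, hlS⟩ := hsat C hC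
        refine ⟨_, hl, ?_⟩
        by_contra hne
        rw [Bool.not_eq_false] at hne
        cases b
        · obtain ⟨x, hx, hxv⟩ := knownFalse_neg.1 hne
          obtain ⟨i, hi, rfl⟩ := List.mem_map.1 hx
          have hv : v ∉ S := by simpa using hlS
          simp only at hxv
          rcases Nat.eq_zero_or_pos i with rfl | h
          · omega
          · obtain ⟨w, hw, h⟩ := hsmem i h (hI i hi)
            obtain rfl : v = w := by omega
            exact hv hw
        · obtain ⟨x, hx, y, hy, hxv, hor⟩ := knownFalse_pos.1 hne
          obtain ⟨i, hi, rfl⟩ := List.mem_map.1 hx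
          obtain ⟨j, hj, rfl⟩ := List.mem_map.1 hy
          have hv : v ∈ S := by simpa using hlS
          obtain ⟨m, hm₁, hmk, hm⟩ := hsurj v hv
          simp only at hxv hor
          have him : i < m := by
            by_contra hlt
            rcases (Nat.le_of_not_lt hlt).eq_or_lt with rfl | hlt
            · omega
            · have := hmono m i hlt (hI i hi)
              omega
          rcases hor with ⟨rfl, hj⟩ | ⟨rfl, -⟩
          · rcases (Nat.succ_le_of_lt him).eq_or_lt with heq | hlt
            · rw [Nat.succ_eq_add_one] at heq
              rw [heq] at hj
              omega
            · have := hmono _ m hlt hmk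
              simp only [Nat.succ_eq_add_one] at this
              omega
          · omega
  · rintro ⟨τ, hτ, h⟩
    have hrep : ∀ i ≤ k, List.replicate (2 * d) i ∈ indexTuples k (2 * d) := fun i hi =>
      mem_indexTuples.2 ⟨by simp, fun j hj => by rw [List.eq_of_mem_replicate hj]; exact hi⟩
    have hex : ∀ i, ∃ a, i ≤ k → (i, a) ∈ τ (List.replicate (2 * d) i) := by
      intro i
      by_cases hi : i ≤ k
      · have h₁ := (compatible_iff.1 (h _ (hrep i hi) _ (hrep i hi))).1
        have h₂ : i ∈ (τ (List.replicate (2 * d) i)).map fun x => x.1 := by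
          -- Here `1 ≤ d` is needed: the constant tuple must not be empty.
          rw [h₁, List.mem_replicate]; exact ⟨by omega, rfl⟩
        obtain ⟨⟨j, a⟩, hx, rfl⟩ := List.mem_map.1 h₂
        exact ⟨a, fun _ => hx⟩
      · exact ⟨0, fun h => absurd h hi⟩
    choose s hs using hex
    have hτs : ∀ I ∈ indexTuples k (2 * d), ∀ x ∈ τ I, x.1 ≤ k ∧ x.2 = s x.1 := by
      intro I hI x hx
      have hxk := ((mem_valueTuples.1 (hτ I hI)).2 x hx).1
      have := (compatible_iff.1 (h I hI _ (hrep x.1 hxk))).2.2.1 x hx _ (hs x.1 hxk)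
      exact ⟨hxk, this.1 rfl⟩
    have hmono : ∀ i j, i < j → j ≤ k → s i < s j := by
      intro i j hij hj
      have hi : i ≤ k := by omega
      exact ((compatible_iff.1 (h _ (hrep i hi) _ (hrep j hj))).2.2.1 _ (hs i hi) _
        (hs j hj)).2 hij
    have hs0 : s 0 = 0 := (compatible_iff.1 (h _ (hrep 0 (Nat.zero_le k)) _
      (hrep 0 (Nat.zero_le k)))).2.2.2.1 _ (hs 0 (Nat.zero_le k)) rfl
    have hpos : ∀ i, 1 ≤ i → i ≤ k → 0 < s i := fun i h₁ h₂ => by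
      have := hmono 0 i h₁ h₂
      omega
    let S : Finset ℕ := (Finset.Icc 1 k).image fun i => s i - 1
    have hS : ∀ v, v ∈ S ↔ ∃ i, 1 ≤ i ∧ i ≤ k ∧ s i = v + 1 := by
      intro v
      simp only [S, Finset.mem_image, Finset.mem_Icc]
      constructor
      · rintro ⟨i, ⟨h₁, h₂⟩, rfl⟩
        have := hpos i h₁ h₂
        exact ⟨i, h₁, h₂, by omega⟩
      · rintro ⟨i, h₁, h₂, h₃⟩
        exact ⟨i, ⟨h₁, h₂⟩, by omega⟩
    refine ⟨S, fun v hv => ?_, ?_, fun C hC => ?_⟩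
    · obtain ⟨i, h₁, h₂, h₃⟩ := (hS v).1 hv
      rcases ((mem_valueTuples.1 (hτ _ (hrep i h₂))).2 _ (hs i h₂)).2 with h₄ | ⟨w, hw, h₄⟩
      · simp only at h₄; omega
      · simp only at h₄
        obtain rfl : v = w := by omega
        exact hw
    · rw [Finset.card_image_of_injOn]
      · simp
      · intro i hi j hj hij
        have hi := Finset.mem_Icc.1 hi
        have hj := Finset.mem_Icc.1 hj
        have h₁ := hpos i hi.1 hi.2
        have h₂ := hpos j hj.1 hj.2
        simp only at hij
        rcases lt_trichotomy i j with hlt | heq | hlt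
        · have := hmono i j hlt hj.2
          omega
        · exact heq
        · have := hmono j i hlt hi.2
          omega
    · by_contra hcon
      push Not at hcon
      obtain ⟨I, hI, hIk, hknown⟩ := exists_knownFalse_clause hs0 hS C fun l hl => by
        have := hcon l hl
        tauto
      have hlen := hφ C hC
      -- Clauses shorter than `d` need fewer indices; the tuple is filled up with the index 0.
      let I' := I ++ List.replicate (2 * d - I.length) 0
      have hI' : I' ∈ indexTuples k (2 * d) := by
        refine mem_indexTuples.2 ⟨by simp [I']; omega, fun i hi => ?_⟩
        rcases List.mem_append.1 hi with hi | hi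
        · exact hIk i hi
        · rw [List.eq_of_mem_replicate hi]; exact Nat.zero_le _
      obtain ⟨h₁, -, -, -, h₅⟩ := compatible_iff.1 (h I' hI' I' hI')
      obtain ⟨l, hl, hfalse⟩ := h₅ C hC
      have := hknown (τ I') (fun i hi => by
        have : i ∈ (τ I').map fun x => x.1 := by
          rw [h₁]; exact List.mem_append_left _ hi
        obtain ⟨⟨j, a⟩, hx, rfl⟩ := List.mem_map.1 this
        have ha := (hτs I' hI' _ hx).2
        simp only at ha
        rw [← ha]
        exact hx) l hl
      rw [this] at hfalse
      simp at hfalse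

/-! ## The reduction -/

namespace PolyTime

variable {α β : Type} [DataEnc α] [DataEnc β]

-- A fold over the numbered list keeps the default until position `p x` is met. Its states are the
-- default or entries of the list, hence of bounded size.
@[fun_prop]
theorem getD {l : α → List β} {p : α → ℕ} (hl : PolyTime l) (hp : PolyTime p) (b : β) :
    PolyTime fun x => (l x).getD (p x) b := by
  obtain ⟨Tl, hTl⟩ := hl.codeSize_bound
  have key : ∀ (m : List β) (n i : ℕ) (s : β),
      (m.zipIdx n).foldl (fun s y => bif decide (y.2 = i) then y.1 else s) s =
        if n ≤ i then m.getD (i - n) s else s := by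
    intro m
    induction m with
    | nil => intro n i s; simp
    | cons c m ih =>
      intro n i s
      rw [List.zipIdx_cons, List.foldl_cons, ih]
      rcases lt_trichotomy n i with hlt | rfl | hlt
      · obtain ⟨e, rfl⟩ : ∃ e, i = n + 1 + e := ⟨i - (n + 1), by omega⟩
        have h₁ : ¬ n = n + 1 + e := by omega
        have h₂ : n + 1 + e - n = e + 1 := by omega
        simp [h₁, h₂, show n ≤ n + 1 + e by omega]
      · simp
      · simp [hlt.ne', show ¬ n + 1 ≤ i by omega, show ¬ n ≤ i by omega]
  have bound : ∀ (m : List (β × ℕ)) (i B : ℕ) (s : β), codeSize s ≤ B →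
      (∀ y ∈ m, codeSize y.1 ≤ B) →
      codeSize (m.foldl (fun s y => bif decide (y.2 = i) then y.1 else s) s) ≤ B := by
    intro m i B
    induction m with
    | nil => intro s hs _; exact hs
    | cons c m ih =>
      intro s hs hm
      refine ih _ ?_ fun y hy => hm y (List.mem_cons_of_mem _ hy)
      beta_reduce
      cases decide (c.2 = i)
      · exact hs
      · exact hm c List.mem_cons_self
  have := foldl_of_bound (l := fun x => (l x).zipIdx)
    (f := fun x s y => bif decide (y.2 = p x) then y.1 else s) (i := fun _ => b)
    (by fun_prop) (by fun_prop) (const _) (Tl + .C (codeSize b)) (by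
      intro x l₁ l₂ h
      rw [Polynomial.eval_add, Polynomial.eval_C]
      refine bound _ _ _ _ (by omega) fun y hy => ?_
      have hy' : y ∈ (l x).zipIdx := by rw [h]; exact List.mem_append_left _ hy
      have h₁ := codeSize_le_of_mem (List.fst_mem_of_mem_zipIdx hy')
      have h₂ := hTl x
      omega)
  simpa only [key, Nat.zero_le, if_true, Nat.sub_zero] using this

@[fun_prop]
theorem listTuples {l : α → List β} (hl : PolyTime l) (n : ℕ) :
    PolyTime fun x => listTuples (l x) n := by
  induction n with
  | zero => exact const _
  | succ n ih =>
    simp only [_root_.listTuples]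
    exact hl.flatMap ((ih.comp prod_fst).map (by fun_prop))

@[fun_prop]
theorem knownFalse {k : α → ℕ} {ρ : α → List (ℕ × ℕ)} {l : α → Literal} (hk : PolyTime k)
    (hρ : PolyTime ρ) (hl : PolyTime l) : PolyTime fun x => knownFalse (k x) (ρ x) (l x) := by
  unfold _root_.knownFalse
  fun_prop

@[fun_prop]
theorem compatible {φ : α → CNF} {k : α → ℕ} {I J : α → List ℕ} {ρ τ : α → List (ℕ × ℕ)}
    (hφ : PolyTime φ) (hk : PolyTime k) (hI : PolyTime I) (hJ : PolyTime J) (hρ : PolyTime ρ)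
    (hτ : PolyTime τ) : PolyTime fun x => compatible (φ x) (k x) (I x) (J x) (ρ x) (τ x) := by
  unfold _root_.compatible
  fun_prop

end PolyTime

/-- For fixed `d` the construction is polynomial in the formula and in `k` written in unary. There
are `(k + 1) ^ (2 * d)` index tuples, so the new parameter depends on `k` only. -/
theorem weightedSat_fptReducible {Γ : ConstraintLang} (G : Gadgets Γ) {d : ℕ} (hd : 1 ≤ d) :
    (weightedSat d).FPTReducible (weightedMinSAT Γ) := by
  let D := 2 * d
  let r : {φ : CNF // ∀ C ∈ φ, C.length ≤ d} × ℕ → WMinSATInst Γ := fun x =>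
    G.hardInst (indexTuples x.2 D).length (valueTuples x.1.1 x.2 D).length (allowed x.1.1 x.2 D)
  have hr : PolyTime fun y : {φ : CNF // ∀ C ∈ φ, C.length ≤ d} × List ℕ =>
      r (y.1, y.2.length) := by
    have hφ : PolyTime fun y : {φ : CNF // ∀ C ∈ φ, C.length ≤ d} × List ℕ => y.1.1 := by
      -- An element of the subtype has the same code as the formula, so the same program works.
      obtain ⟨p, T, h⟩ := (PolyTime.prod_fst :
        PolyTime fun y : {φ : CNF // ∀ C ∈ φ, C.length ≤ d} × List ℕ => y.1)
      exact ⟨p, T, h⟩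
    have hk : PolyTime fun y : {φ : CNF // ∀ C ∈ φ, C.length ≤ d} × List ℕ => y.2.length := by
      fun_prop
    have hrange : PolyTime fun y : {φ : CNF // ∀ C ∈ φ, C.length ≤ d} × List ℕ =>
        List.range (y.2.length + 1) := PolyTime.range_succ (by fun_prop)
    have hK : PolyTime fun y : {φ : CNF // ∀ C ∈ φ, C.length ≤ d} × List ℕ =>
        indexTuples y.2.length D := hrange.listTuples D
    have hV : PolyTime fun y : {φ : CNF // ∀ C ∈ φ, C.length ≤ d} × List ℕ =>
        valueTuples y.1.1 y.2.length D := by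
      have h₁ : PolyTime fun y : {φ : CNF // ∀ C ∈ φ, C.length ≤ d} × List ℕ =>
          0 :: y.1.1.flatMap fun C => C.map fun l => l.1 + 1 :=
        (PolyTime.const 0).cons (hφ.flatMap (by fun_prop))
      exact (hrange.flatMap ((h₁.comp PolyTime.prod_fst).map (by fun_prop))).listTuples D
    refine PolyTime.hardInst G hK.range_length hV.range_length ?_
    have pr₁ : ∀ {β : Type} [DataEnc β]
        {f : {φ : CNF // ∀ C ∈ φ, C.length ≤ d} × List ℕ → β}, PolyTime f →
        PolyTime fun y : ((((({φ : CNF // ∀ C ∈ φ, C.length ≤ d} × List ℕ) × ℕ) × ℕ) × ℕ) × ℕ) =>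
          f y.1.1.1.1 := fun hf => hf.comp (by fun_prop)
    exact (pr₁ hφ).compatible (pr₁ hk) ((pr₁ hK).getD (by fun_prop) [])
      ((pr₁ hK).getD (by fun_prop) []) ((pr₁ hV).getD (by fun_prop) [])
      ((pr₁ hV).getD (by fun_prop) [])
  obtain ⟨p, f, c, hf, hp⟩ := hr.fpt_of_unary
  have hcard : ∀ (m n : ℕ), (listTuples (List.range m) n).length = m ^ n := by
    intro m n
    induction n with
    | zero => rfl
    | succ n ih => simp [listTuples, List.length_flatMap, ih, pow_succ, mul_comm]
  refine ⟨r, p, f, fun k => G.boundK ((k + 1) ^ D), c, hf, ?_, fun x => ⟨?_, ?_, ?_⟩⟩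
  · have := (((.X + 1) ^ D * (.X + 1) ^ D * (2 * .C G.c) +
      (.X + 1) ^ D * (.X + 1) ^ D : Polynomial ℕ)).computable_eval_nat
    simpa [Gadgets.boundK] using this
  · have h₁ := exists_satisfying_iff hd x.1.2 x.2
    have h₂ := exists_allowed_iff x.1.1 x.2 D
    refine h₁.trans (h₂.symm.trans ⟨?_, G.exists_solution_of_hardInst_yes⟩)
    rintro ⟨σ, hσ, hA⟩
    exact G.hardInst_yes_of_solution hσ hA
  · change G.boundK (indexTuples x.2 D).length ≤ G.boundK ((x.2 + 1) ^ D)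
    rw [indexTuples, hcard]
  · obtain ⟨t, ht, hrun⟩ := hp x.1 x.2
    rw [List.length_replicate] at hrun
    exact ⟨t, hrun, ht⟩

theorem mainTheorem12 (Γ : ConstraintLang)
    (hGaifman : ∃ R ∈ Γ, SimpleGraph.IsIndContained twoK₂ R.gaifman)
    (hCrisp : SupportsCrisp Γ BoolRel.negClause₂)
    (hImpl : PropImplements Γ BoolRel.equality.costFn ∨
      PropImplements Γ BoolRel.implication.costFn) :
    TrivialMinSAT Γ ∨ W1Hard (weightedMinSAT Γ) := by
  by_cases htriv : TrivialMinSAT Γ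
  · exact .inl htriv
  · obtain ⟨G⟩ := nonempty_gadgets hGaifman hCrisp hImpl htriv
    exact .inr fun P ⟨d, hd, hP⟩ => hP.trans (weightedSat_fptReducible G hd)
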